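/- **Proposition.** Write $\mathtt{sSet}$ for the category of simplicial sets and $\mathtt{sCat}$ for the category of small simplicially enriched categories. Put $I=\Delta^1$ and $(a,b)=\{c\in\mathbb N\mid a<c<b\}$. For $n\ge 0$ let $\mathbf{\Delta}_{\mathfrak N}^n$ be the simplicial category with objects $0,\dots,n$, with $\mathbf{\Delta}_{\mathfrak N}^n(a,b)=I^{(a,b)}$ if $a\le b$ and $\mathbf{\Delta}_{\mathfrak N}^n(a,b)=\emptyset$ otherwise, and with the composition $I^{(b,c)}\times I^{(a,b)}\to I^{(a,c)}$ that juxtaposes coordinates and, if $a<b<c$, inserts the constant $0$ at the place $b$. A non-decreasing map $f:[m]\to[n]$ induces the simplicial functor $f_*:\mathbf{\Delta}_{\mathfrak N}^m\to\mathbf{\Delta}_{\mathfrak N}^n$ that is $f$ on objects and sends the vertex $(1,\dots,1)$ of $I^{(a,b)}$ to the vertex $(1,\dots,1)$ of $I^{(f(a),f(b))}$. Let $\mathbf{\Delta}_{\mathfrak N}:\mathtt{sSet}\to\mathtt{sCat}$ be the colimit-preserving functor that extends this cosimplicial object, so that $\mathbf{\Delta}_{\mathfrak N}(\Delta^n)=\mathbf{\Delta}_{\mathfrak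 N}^n$. For a simplicial category $\mathcal C$, let $\pi_0(\mathcal C)$ be the category with the same objects and with $\operatorname{Hom}_{\pi_0(\mathcal C)}(x,y)=\pi_0(\mathcal C(x,y))$. A simplicial functor $F:\mathcal C\to\mathcal D$ is a *strong equivalence* if all the maps $\mathcal C(x,y)\to\mathcal D(Fx,Fy)$ are weak equivalences of simplicial sets, $\pi_0(F)$ induces a weak homotopy equivalence of nerves, and $\pi_0(F)$ is an equivalence of categories. The *cofibrations* of $\mathtt{sCat}$ are generated by the functor $\emptyset\to *$ and the functors $K_{01}\to L_{01}$ induced by the monomorphisms $K\to L$ of simplicial sets, where $K_{01}$ has two objects $0,1$, with $K_{01}(0,1)=K$ and no other maps besides the identities; that is, they are the functors with the left lifting property with respect to every functor that has the right lifting property with respect to all these generators. A *strong acyclic cofibration* is a cofibration that is a strong equivalence. Let $0<i<n$, and let $\Lambda^n_i\subset\Delta^n$ be the $i$-th horn. Then the simplicial functor $$\mathbf{\Delta}_{\mathfrak N}(\Lambda^n_i)\longrightarrow\mathbf{\Delta}_{\mathfrak N}(\Delta^n)=\mathbf{\Delta}_{\mathfrak N}^n$$ induced by the inclusion of the horn is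 a strong acyclic cofibration. -/

import Mathlib

open CategoryTheory MonoidalCategory Opposite Limits

namespace CohNerve

/-- The simplex of a product with the given components. -/
abbrev pair {X Y : SSet.{0}} {m : SimplexCategoryᵒᵖ} (f : X.obj m) (g : Y.obj m) :
    (X ⊗ Y).obj m := (f, g)

/-- A simplicial category with set of objects `Ob`, described simplex by simplex: a category
in every simplicial degree, with simplicial operators that are functors fixing the objects. -/
structure Levelwise (Ob : Type) where
  Hom : Ob → Ob → SSet.{0}
  one (x : Ob) (m : SimplexCategoryᵒᵖ) : (Hom x x).obj m
  comp {x y z : Ob} {m : SimplexCategoryᵒᵖ} :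
    (Hom x y).obj m → (Hom y z).obj m → (Hom x z).obj m
  map_one (x : Ob) {m m' : SimplexCategoryᵒᵖ} (θ : m ⟶ m') :
    (Hom x x).map θ (one x m) = one x m'
  map_comp {x y z : Ob} {m m' : SimplexCategoryᵒᵖ} (θ : m ⟶ m')
    (f : (Hom x y).obj m) (g : (Hom y z).obj m) :
    (Hom x z).map θ (comp f g) = comp ((Hom x y).map θ f) ((Hom y z).map θ g)
  one_comp {x y : Ob} {m : SimplexCategoryᵒᵖ} (f : (Hom x y).obj m) : comp (one x m) f = f
  comp_one {x y : Ob} {m : SimplexCategoryᵒᵖ} (f : (Hom x y).obj m) : comp f (one y m) = f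
  assoc {w x y z : Ob} {m : SimplexCategoryᵒᵖ} (f : (Hom w x).obj m) (g : (Hom x y).obj m)
    (h : (Hom y z).obj m) : comp (comp f g) h = comp f (comp g h)

/-- The enriched category given by levelwise data. -/
@[reducible] def Levelwise.toEnriched {Ob : Type} (L : Levelwise Ob) :
    EnrichedCategory SSet.{0} Ob where
  Hom := L.Hom
  id x := { app := fun m => ↾fun _ => L.one x m
            naturality := fun m m' θ => by ext; exact (L.map_one x θ).symm }
  comp x y z := { app := fun m => ↾fun p => L.comp p.1 p.2
                  naturality := fun m m' θ => by ext p; exact (L.map_comp θ p.1 p.2).symm }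
  id_comp x y := by ext m f; exact L.one_comp f
  comp_id x y := by ext m f; exact L.comp_one f
  assoc w x y z := by ext m f; exact L.assoc f.1 f.2.1 f.2.2

/-- A small simplicial (that is, simplicially enriched) category. -/
structure SCat where
  Ob : Type
  [str : EnrichedCategory SSet.{0} Ob]

attribute [instance] SCat.str

/-- The category `sCat` of small simplicial categories and simplicial functors. -/
instance : Category SCat where
  Hom C D := EnrichedFunctor SSet.{0} C.Ob D.Ob
  id C := EnrichedFunctor.id SSet.{0} C.Ob
  comp F G := EnrichedFunctor.comp SSet.{0} F G

namespace SCat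

/-- The simplicial set of maps from `x` to `y`. -/
abbrev Map (C : SCat) (x y : C.Ob) : SSet.{0} := x ⟶[SSet.{0}] y

section
variable {C : SCat} {w x y z : C.Ob} {m m' : SimplexCategoryᵒᵖ}

/-- The identity of `x`, as an `m`-simplex. -/
def one (x : C.Ob) (m : SimplexCategoryᵒᵖ) : (C.Map x x).obj m :=
  (eId SSet.{0} x).app m PUnit.unit

/-- Composition of `m`-simplices (first `f`, then `g`). -/
def comp (f : (C.Map x y).obj m) (g : (C.Map y z).obj m) : (C.Map x z).obj m :=
  (eComp SSet.{0} x y z).app m (pair f g)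

lemma map_one (θ : m ⟶ m') : (C.Map x x).map θ (one x m) = one x m' :=
  (ConcreteCategory.congr_hom ((eId SSet.{0} x).naturality θ) PUnit.unit).symm

lemma map_comp (θ : m ⟶ m') (f : (C.Map x y).obj m) (g : (C.Map y z).obj m) :
    (C.Map x z).map θ (comp f g) = comp ((C.Map x y).map θ f) ((C.Map y z).map θ g) :=
  (ConcreteCategory.congr_hom ((eComp SSet.{0} x y z).naturality θ)
    (pair (X := C.Map x y) (Y := C.Map y z) f g)).symm

lemma one_comp (f : (C.Map x y).obj m) : comp (one x m) f = f :=
  ConcreteCategory.congr_hom (congr_app (e_id_comp SSet.{0} x y) m) f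

lemma comp_one (f : (C.Map x y).obj m) : comp f (one y m) = f :=
  ConcreteCategory.congr_hom (congr_app (e_comp_id SSet.{0} x y) m) f

lemma assoc (f : (C.Map w x).obj m) (g : (C.Map x y).obj m) (h : (C.Map y z).obj m) :
    comp (comp f g) h = comp f (comp g h) :=
  ConcreteCategory.congr_hom (congr_app (e_assoc SSet.{0} w x y z) m)
    (pair (X := C.Map w x) (Y := C.Map x y ⊗ C.Map y z) f (pair (X := C.Map x y) g h))
end

/-- The simplicial functor given by its values on objects and on simplices of maps. -/
@[simps] def mkHom {C D : SCat} (obj : C.Ob → D.Ob)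
    (map : ∀ {x y : C.Ob} {m : SimplexCategoryᵒᵖ},
      (C.Map x y).obj m → (D.Map (obj x) (obj y)).obj m)
    (nat : ∀ {x y : C.Ob} {m m' : SimplexCategoryᵒᵖ} (θ : m ⟶ m') (f : (C.Map x y).obj m),
      map ((C.Map x y).map θ f) = (D.Map (obj x) (obj y)).map θ (map f))
    (map_one : ∀ (x : C.Ob) (m : SimplexCategoryᵒᵖ), map (one x m) = one (obj x) m)
    (map_comp : ∀ {x y z : C.Ob} {m : SimplexCategoryᵒᵖ} (f : (C.Map x y).obj m)
      (g : (C.Map y z).obj m), map (comp f g) = comp (map f) (map g)) : C ⟶ D where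
  obj := obj
  map x y := { app := fun m => ↾fun f => map f
               naturality := fun m m' θ => by ext f; exact nat θ f }
  map_id x := by ext m f; exact map_one x m
  map_comp x y z := by ext m f; exact map_comp f.1 f.2

section
variable {C D E : SCat}

/-- The action of a simplicial functor on objects. -/
abbrev fobj (F : C ⟶ D) : C.Ob → D.Ob := EnrichedFunctor.obj F

/-- The action of a simplicial functor on simplicial sets of maps. -/
abbrev fmap (F : C ⟶ D) (x y : C.Ob) : C.Map x y ⟶ D.Map (fobj F x) (fobj F y) :=
  EnrichedFunctor.map F x y

lemma fmap_one (F : C ⟶ D) (x : C.Ob) (m : SimplexCategoryᵒᵖ) :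
    (fmap F x x).app m (one x m) = one (fobj F x) m :=
  ConcreteCategory.congr_hom (congr_app (EnrichedFunctor.map_id F x) m) PUnit.unit

lemma fmap_comp (F : C ⟶ D) {x y z : C.Ob} {m : SimplexCategoryᵒᵖ}
    (f : (C.Map x y).obj m) (g : (C.Map y z).obj m) :
    (fmap F x z).app m (comp f g) = comp ((fmap F x y).app m f) ((fmap F y z).app m g) :=
  ConcreteCategory.congr_hom (congr_app (EnrichedFunctor.map_comp F x y z) m)
    (pair (X := C.Map x y) (Y := C.Map y z) f g)

lemma fmap_nat (F : C ⟶ D) {x y : C.Ob} {m m' : SimplexCategoryᵒᵖ} (θ : m ⟶ m')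
    (f : (C.Map x y).obj m) :
    (fmap F x y).app m' ((C.Map x y).map θ f) =
      (D.Map (fobj F x) (fobj F y)).map θ ((fmap F x y).app m f) :=
  ConcreteCategory.congr_hom ((fmap F x y).naturality θ) f

lemma hom_ext (F G : C ⟶ D) (hobj : ∀ x, fobj F x = fobj G x)
    (hmap : ∀ (x y : C.Ob) (m : SimplexCategoryᵒᵖ) (f : (C.Map x y).obj m),
      HEq ((fmap F x y).app m f) ((fmap G x y).app m f)) : F = G := by
  obtain ⟨Fo, Fm, h1, h2⟩ := F
  obtain ⟨Go, Gm, h3, h4⟩ := G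
  obtain rfl : Fo = Go := funext hobj
  obtain rfl : Fm = Gm := by
    funext x y
    ext m f
    exact eq_of_heq (hmap x y m f)
  rfl

lemma heq_of_eq {F G : C ⟶ D} (h : F = G) {x y : C.Ob} {m : SimplexCategoryᵒᵖ}
    (f : (C.Map x y).obj m) : HEq ((fmap F x y).app m f) ((fmap G x y).app m f) := by
  subst h; rfl

lemma comp_heq {x y z x' y' z' : C.Ob} {m : SimplexCategoryᵒᵖ} (hx : x = x') (hy : y = y')
    (hz : z = z') {f : (C.Map x y).obj m} {f' : (C.Map x' y').obj m} (hf : HEq f f')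
    {g : (C.Map y z).obj m} {g' : (C.Map y' z').obj m} (hg : HEq g g') :
    HEq (comp f g) (comp f' g') := by
  subst hx hy hz
  rw [eq_of_heq hf, eq_of_heq hg]

end

end SCat

section Thick

variable {J K L : Type} [LinearOrder J] [LinearOrder K] [LinearOrder L]

/-- An `m`-simplex of `I^{(a,b)}`, where `(a,b) = {c | a < c < b}` and the `k`-simplices of
`I = Δ¹` are the monotone functions `{0,…,k} → {0,1}`; there are none unless `a ≤ b`. -/
@[ext] structure Cube (a b : J) (m : SimplexCategoryᵒᵖ) where
  le : a ≤ b
  coord : Set.Ioo a b → (Fin (m.unop.len + 1) →o Fin 2)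

/-- The simplicial set `I^{(a,b)}` if `a ≤ b`, and the empty one otherwise. -/
def cubeHom (a b : J) : SSet.{0} where
  obj m := Cube a b m
  map θ := ↾fun f => ⟨f.le, fun x => (f.coord x).comp θ.unop.toOrderHom⟩

/-- The simplicial category `thick J`; its composition inserts the constant function `0`
at the middle object `b` (and juxtaposes the coordinates in `(a,b)` and in `(b,c)`). -/
noncomputable def thickLevelwise (J : Type) [LinearOrder J] : Levelwise J where
  Hom a b := cubeHom a b
  one a m := ⟨le_rfl, fun _ => OrderHom.const _ 0⟩
  comp {a b c} m f g := ⟨f.le.trans g.le, fun x =>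
    if h : x.1 < b then f.coord ⟨x.1, x.2.1, h⟩
    else if h' : b < x.1 then g.coord ⟨x.1, h', x.2.2⟩
    else OrderHom.const _ 0⟩
  map_one a m m' θ := by
    refine Cube.ext (funext fun x => ?_)
    exact absurd (x.2.1.trans x.2.2) (lt_irrefl _)
  map_comp {a b c m m'} θ f g := by
    refine Cube.ext (funext fun x => ?_)
    change OrderHom.comp (dite _ _ _) _ = dite _ _ _
    split_ifs <;> rfl
  one_comp {a b m} f := by
    refine Cube.ext (funext fun x => ?_)
    have h1 : ¬ x.1 < a := not_lt.2 x.2.1.le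
    simp [h1, x.2.1]
  comp_one {a b m} f := by
    refine Cube.ext (funext fun x => ?_)
    simp [x.2.2]
  assoc {a b c d m} f g h := by
    refine Cube.ext (funext fun x => ?_)
    have := f.le
    have := g.le
    have := h.le
    dsimp only
    split_ifs <;> first | rfl | (exfalso; order)

/-- The simplicial category `𝚫_𝔑` of a linear order; for `J = {0 < ⋯ < n}` it is `𝚫_𝔑ⁿ`. -/
noncomputable def thick (J : Type) [LinearOrder J] : SCat :=
  letI := (thickLevelwise J).toEnriched
  { Ob := J }

/-- The simplicial functor `φ_*` induced by a monotone map `φ`. On maps it is the map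
`I^{(a,b)} → I^{(φ a, φ b)}` whose `y`-th coordinate is the infimum of the coordinates `x`
with `φ x = y` (in particular `1` if there are none). -/
noncomputable def thickMap (φ : J →o K) : thick J ⟶ thick K :=
  SCat.mkHom (C := thick J) (D := thick K) (fun a => φ a)
    (fun {a b m} (f : Cube (J := J) a b m) => (⟨φ.monotone f.le, fun y =>
      ⨅ x : {x : Set.Ioo (α := J) a b // φ x.1 = y.1}, f.coord x.1⟩ : Cube (φ a) (φ b) m))
    (fun {a b m m'} θ (f : Cube (J := J) a b m) => by
      refine Cube.ext (funext fun y => ?_)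
      apply OrderHom.ext
      funext t
      change iInf (fun x : {x : Set.Ioo (α := J) a b // φ x.1 = y.1} =>
          (f.coord x.1).comp θ.unop.toOrderHom) t =
        iInf (fun x : {x : Set.Ioo (α := J) a b // φ x.1 = y.1} => f.coord x.1)
          (θ.unop.toOrderHom t)
      rw [OrderHom.iInf_apply, OrderHom.iInf_apply]
      rfl)
    (fun a m => by
      refine Cube.ext (funext fun y => ?_)
      exact absurd (y.2.1.trans y.2.2) (lt_irrefl _))
    (fun {a b c : J} {m} (f : Cube a b m) (g : Cube b c m) => by
      refine Cube.ext (funext fun y => ?_)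
      change iInf (fun x : {x : Set.Ioo (α := J) a c // φ x.1 = y.1} =>
          if h : x.1.1 < b then f.coord ⟨x.1.1, x.1.2.1, h⟩
          else if h' : b < x.1.1 then g.coord ⟨x.1.1, h', x.1.2.2⟩ else OrderHom.const _ 0) =
        if h : y.1 < φ b then
          iInf (fun x : {x : Set.Ioo (α := J) a b // φ x.1 = y.1} => f.coord x.1)
        else if h' : φ b < y.1 then
          iInf (fun x : {x : Set.Ioo (α := J) b c // φ x.1 = y.1} => g.coord x.1)
        else OrderHom.const _ 0
      split_ifs with h h'
      · apply le_antisymm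
        · refine le_iInf fun x => (iInf_le _ ⟨⟨x.1.1, x.1.2.1, x.1.2.2.trans_le g.le⟩, x.2⟩).trans ?_
          simp [x.1.2.2]
        · refine le_iInf fun x => ?_
          have hx : x.1.1 < b := by
            by_contra hx
            exact absurd (φ.monotone (not_lt.1 hx)) (not_le.2 (by rw [x.2]; exact h))
          refine (iInf_le _ ⟨⟨x.1.1, x.1.2.1, hx⟩, x.2⟩).trans ?_
          simp [hx]
      · apply le_antisymm
        · refine le_iInf fun x => (iInf_le _ ⟨⟨x.1.1, f.le.trans_lt x.1.2.1, x.1.2.2⟩, x.2⟩).trans ?_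
          simp [x.1.2.1, not_lt.2 x.1.2.1.le]
        · refine le_iInf fun x => ?_
          have hx : b < x.1.1 := by
            by_contra hx
            exact absurd (φ.monotone (not_lt.1 hx)) (not_le.2 (by rw [x.2]; exact h'))
          refine (iInf_le _ ⟨⟨x.1.1, hx, x.1.2.2⟩, x.2⟩).trans ?_
          simp [hx, not_lt.2 hx.le]
      · have hy : φ b = y.1 := le_antisymm (not_lt.1 h) (not_lt.1 h')
        have hab : a < b := lt_of_le_of_ne f.le (by rintro rfl; exact absurd y.2.1 (by simp [← hy]))
        have hbc : b < c := lt_of_le_of_ne g.le (by rintro rfl; exact absurd y.2.2 (by simp [← hy]))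
        refine le_antisymm ((iInf_le _ ⟨⟨b, hab, hbc⟩, hy⟩).trans ?_) (fun _ => Fin.zero_le _)
        simp)

lemma thickMap_id : thickMap (OrderHom.id : J →o J) = 𝟙 (thick J) := by
  refine SCat.hom_ext _ _ (fun _ => rfl) fun (a b : J) m (f : Cube a b m) => heq_of_eq ?_
  refine Cube.ext (funext fun y => ?_)
  apply le_antisymm
  · exact iInf_le (fun x : {x : Set.Ioo (α := J) a b // x.1 = y.1} => f.coord x.1) ⟨y, rfl⟩
  · refine le_iInf fun x => le_of_eq ?_
    congr 1
    exact Subtype.ext x.2.symm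

lemma thickMap_comp (φ : J →o K) (ψ : K →o L) :
    thickMap (ψ.comp φ) = thickMap φ ≫ thickMap ψ := by
  refine SCat.hom_ext _ _ (fun _ => rfl) fun (a b : J) m (f : Cube a b m) => heq_of_eq ?_
  refine Cube.ext (funext fun z => ?_)
  change iInf (fun x : {x : Set.Ioo (α := J) a b // ψ (φ x.1) = z.1} => f.coord x.1) =
    iInf (fun y : {y : Set.Ioo (α := K) (φ a) (φ b) // ψ y.1 = z.1} =>
      iInf (fun x : {x : Set.Ioo (α := J) a b // φ x.1 = y.1} => f.coord x.1))
  apply le_antisymm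
  · refine le_iInf fun y => le_iInf fun x => ?_
    exact iInf_le (fun x : {x : Set.Ioo (α := J) a b // ψ (φ x.1) = z.1} => f.coord x.1)
      ⟨x.1, by rw [x.2, y.2]⟩
  · refine le_iInf fun x => ?_
    have h1 : φ a < φ x.1 := lt_of_le_of_ne (φ.monotone x.1.2.1.le) fun h => by
      have := z.2.1
      rw [← x.2, ← h] at this
      exact lt_irrefl _ this
    have h2 : φ x.1 < φ b := lt_of_le_of_ne (φ.monotone x.1.2.2.le) fun h => by
      have := z.2.2
      rw [← x.2, h] at this
      exact lt_irrefl _ this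
    refine (iInf_le _ ⟨⟨φ x.1, h1, h2⟩, x.2⟩).trans ?_
    exact iInf_le (fun x' : {x' : Set.Ioo (α := J) a b // φ x' = φ x.1} => f.coord x'.1) ⟨x.1, rfl⟩

/-- `φ_*` sends the indecomposable vertex `(1,…,1)` of `I^{(a,b)}` to that of
`I^{(φ a, φ b)}`; as every vertex is a composite of such, this determines `φ_*`. -/
lemma thickMap_top (φ : J →o K) {a b : J} (h : a ≤ b) (m : SimplexCategoryᵒᵖ) :
    (SCat.fmap (thickMap φ) a b).app m (⟨h, fun _ => OrderHom.const _ 1⟩ : Cube a b m) =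
      (⟨φ.monotone h, fun _ => OrderHom.const _ 1⟩ : Cube (φ a) (φ b) m) := by
  refine Cube.ext (funext fun y => ?_)
  exact le_antisymm (fun _ => Fin.le_last _) (le_iInf fun _ => le_rfl)

/-- The cosimplicial object `[n] ↦ 𝚫_𝔑ⁿ`. -/
noncomputable def thickCosimplicial : SimplexCategory ⥤ SCat where
  obj n := thick (Fin (n.len + 1))
  map θ := thickMap θ.toOrderHom
  map_id _ := thickMap_id
  map_comp _ _ := thickMap_comp _ _

end Thick

section Generators

/-- The simplicial set with exactly one simplex in every degree. -/
def pt : SSet.{0} where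
  obj _ := PUnit
  map _ := 𝟙 _

/-- The empty simplicial set. -/
def emp : SSet.{0} where
  obj _ := PEmpty
  map _ := 𝟙 _

/-- The empty simplicial category. -/
noncomputable def emptyCat : SCat :=
  letI := Levelwise.toEnriched (Ob := PEmpty)
    { Hom x := x.elim
      one x := x.elim
      comp {x} := x.elim
      map_one x := x.elim
      map_comp {x} := x.elim
      one_comp {x} := x.elim
      comp_one {x} := x.elim
      assoc {x} := x.elim }
  { Ob := PEmpty }

/-- The one-point simplicial category. -/
noncomputable def ptCat : SCat :=
  letI := Levelwise.toEnriched (Ob := PUnit)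
    { Hom _ _ := pt
      one _ _ := PUnit.unit
      comp _ _ := PUnit.unit
      map_one _ _ _ _ := rfl
      map_comp _ _ _ := rfl
      one_comp _ := rfl
      comp_one _ := rfl
      assoc _ _ _ := rfl }
  { Ob := PUnit }

/-- The simplicial functor `∅ → *`. -/
noncomputable def emptyToPt : emptyCat ⟶ ptCat :=
  SCat.mkHom (C := emptyCat) (fun x => PEmpty.elim x) (fun {x} => PEmpty.elim x)
    (fun {x} => PEmpty.elim x) (fun x => PEmpty.elim x) (fun {x} => PEmpty.elim x)

/-- The simplicial sets of maps of `K₀₁`; the objects `0`, `1` are `false`, `true`. -/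
def arrowHom (K : SSet.{0}) : Bool → Bool → SSet.{0}
  | false, false => pt
  | false, true => K
  | true, false => emp
  | true, true => pt

/-- The simplicial category `K₀₁`, in levelwise form. -/
def arrowLevelwise (K : SSet.{0}) : Levelwise (Bool) where
  Hom := arrowHom K
  one
    | false, _ => PUnit.unit
    | true, _ => PUnit.unit
  comp {x y z m} := match x, y, z with
    | false, false, _ => fun _ g => g
    | true, true, _ => fun _ g => g
    | false, true, true => fun f _ => f
    | false, true, false => fun _ g => PEmpty.elim g
    | true, false, _ => fun f _ => PEmpty.elim f
  map_one x m m' θ := by cases x <;> rfl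
  map_comp {x y z m m'} θ f g := by
    cases x <;> cases y <;> cases z <;> rfl
  one_comp {x y m} f := by cases x <;> cases y <;> rfl
  comp_one {x y m} f := by cases x <;> cases y <;> first | rfl | exact PEmpty.elim f
  assoc {w x y z m} f g h := by
    cases w <;> cases x <;> cases y <;> cases z <;>
      first | rfl | exact PEmpty.elim f | exact PEmpty.elim g

/-- The simplicial category `K₀₁` with two objects `0`, `1`, with `K` as simplicial set of maps
from `0` to `1`, and with no other maps besides identities. -/
noncomputable def arrowCat (K : SSet.{0}) : SCat :=
  letI := (arrowLevelwise K).toEnriched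
  { Ob := Bool }

/-- The effect of `K₀₁ → L₀₁` on maps. -/
def arrowHomMap {K L : SSet.{0}} (i : K ⟶ L) : ∀ x y, arrowHom K x y ⟶ arrowHom L x y
  | false, false => 𝟙 pt
  | false, true => i
  | true, false => 𝟙 emp
  | true, true => 𝟙 pt

/-- The simplicial functor `K₀₁ → L₀₁` induced by `i : K ⟶ L`. -/
noncomputable def arrowMap {K L : SSet.{0}} (i : K ⟶ L) : arrowCat K ⟶ arrowCat L :=
  SCat.mkHom (C := arrowCat K) (D := arrowCat L) (fun x => x)
    (fun {x y m} f => (arrowHomMap i x y).app m f)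
    (fun {x y m m'} θ f => ConcreteCategory.congr_hom ((arrowHomMap i x y).naturality θ) f)
    (fun (x : Bool) m => by cases x <;> rfl)
    (fun {x y z : Bool} {m} f g => by
      cases x <;> cases y <;> cases z <;> rfl)

end Generators


section Colimits

variable {A : Type} [SmallCategory A] (D : A ⥤ SCat)

/-- The objects of the colimit of `D`: the colimit of the sets of objects. -/
def ColimOb : Type :=
  Quot fun (p q : Σ a, (D.obj a).Ob) =>
    ∃ u : p.1 ⟶ q.1, SCat.fobj (D.map u) p.2 = q.2

/-- The class of an object of `D.obj a`. -/
def ColimOb.mk (a : A) (x : (D.obj a).Ob) : ColimOb D := Quot.mk _ ⟨a, x⟩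

lemma ColimOb.sound {a b : A} (u : a ⟶ b) (x : (D.obj a).Ob) :
    ColimOb.mk D b (SCat.fobj (D.map u) x) = ColimOb.mk D a x :=
  (Quot.sound ⟨u, rfl⟩).symm

/-- Formal composites of `m`-simplices of maps of the simplicial categories `D.obj a`. -/
inductive Word (m : SimplexCategoryᵒᵖ) : ColimOb D → ColimOb D → Type
  | gen {p q : ColimOb D} (a : A) (x y : (D.obj a).Ob) (hx : ColimOb.mk D a x = p)
      (hy : ColimOb.mk D a y = q) (f : ((D.obj a).Map x y).obj m) : Word m p q
  | one (p : ColimOb D) : Word m p p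
  | comp {p q r : ColimOb D} (v : Word m p q) (w : Word m q r) : Word m p r

/-- The relations among formal composites: the axioms of a category, and those
saying that every `D.obj a` maps functorially to the colimit, compatibly with `D.map`. -/
inductive Rel {m : SimplexCategoryᵒᵖ} :
    ∀ {p q : ColimOb D}, Word D m p q → Word D m p q → Prop
  | refl {p q} (v : Word D m p q) : Rel v v
  | symm {p q} {v w : Word D m p q} : Rel v w → Rel w v
  | trans {p q} {u v w : Word D m p q} : Rel u v → Rel v w → Rel u w
  | congr {p q r} {v v' : Word D m p q} {w w' : Word D m q r} :
      Rel v v' → Rel w w' → Rel (.comp v w) (.comp v' w')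
  | one_comp {p q} (v : Word D m p q) : Rel (.comp (.one p) v) v
  | comp_one {p q} (v : Word D m p q) : Rel (.comp v (.one q)) v
  | assoc {p q r s} (u : Word D m p q) (v : Word D m q r) (w : Word D m r s) :
      Rel (.comp (.comp u v) w) (.comp u (.comp v w))
  | gen_one {p} (a : A) (x : (D.obj a).Ob) (hx : ColimOb.mk D a x = p) :
      Rel (.gen a x x hx hx (SCat.one x m)) (.one p)
  | gen_comp {p q r} (a : A) (x y z : (D.obj a).Ob) (hx : ColimOb.mk D a x = p)
      (hy : ColimOb.mk D a y = q) (hz : ColimOb.mk D a z = r)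
      (f : ((D.obj a).Map x y).obj m) (g : ((D.obj a).Map y z).obj m) :
      Rel (.gen a x z hx hz (SCat.comp f g)) (.comp (.gen a x y hx hy f) (.gen a y z hy hz g))
  | gen_map {p q} {a b : A} (u : a ⟶ b) (x y : (D.obj a).Ob) (hx : ColimOb.mk D a x = p)
      (hy : ColimOb.mk D a y = q) (f : ((D.obj a).Map x y).obj m) :
      Rel (.gen b _ _ ((ColimOb.sound D u x).trans hx) ((ColimOb.sound D u y).trans hy)
        ((SCat.fmap (D.map u) x y).app m f)) (.gen a x y hx hy f)

variable {D}

/-- The simplicial operators on formal composites. -/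
def Word.map {m m' : SimplexCategoryᵒᵖ} (θ : m ⟶ m') :
    ∀ {p q : ColimOb D}, Word D m p q → Word D m' p q
  | _, _, .gen a x y hx hy f => .gen a x y hx hy (((D.obj a).Map x y).map θ f)
  | _, _, .one p => .one p
  | _, _, .comp v w => .comp (v.map θ) (w.map θ)

lemma Rel.map {m m' : SimplexCategoryᵒᵖ} (θ : m ⟶ m') {p q : ColimOb D} {v w : Word D m p q}
    (h : Rel D v w) : Rel D (v.map θ) (w.map θ) := by
  induction h with
  | refl v => exact .refl _
  | symm _ ih => exact .symm ih
  | trans _ _ ih ih' => exact .trans ih ih'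
  | congr _ _ ih ih' => exact .congr ih ih'
  | one_comp v => exact .one_comp _
  | comp_one v => exact .comp_one _
  | assoc u v w => exact .assoc _ _ _
  | gen_one a x hx =>
    simp only [Word.map, SCat.map_one]
    exact .gen_one a x hx
  | gen_comp a x y z hx hy hz f g =>
    simp only [Word.map, SCat.map_comp]
    exact .gen_comp a x y z hx hy hz _ _
  | gen_map u x y hx hy f =>
    simp only [Word.map, ← SCat.fmap_nat]
    exact .gen_map u x y hx hy _

lemma Word.map_id {m : SimplexCategoryᵒᵖ} {p q : ColimOb D} (v : Word D m p q) :
    v.map (𝟙 m) = v := by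
  induction v with
  | gen a x y hx hy f => simp [Word.map]
  | one p => rfl
  | comp v w ih ih' => simp [Word.map, ih, ih']

lemma Word.map_map {m m' m'' : SimplexCategoryᵒᵖ} (θ : m ⟶ m') (η : m' ⟶ m'') {p q : ColimOb D}
    (v : Word D m p q) : v.map (θ ≫ η) = (v.map θ).map η := by
  induction v with
  | gen a x y hx hy f => simp [Word.map]
  | one p => rfl
  | comp v w ih ih' => simp [Word.map, ih, ih']

variable (D)

/-- The simplicial sets of maps of the colimit of `D`. -/
def colimHom (p q : ColimOb D) : SSet.{0} where
  obj m := Quot (Rel D (m := m) (p := p) (q := q))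
  map θ := ↾Quot.map (Word.map θ) (fun _ _ h => h.map θ)
  map_id m := by
    ext v
    obtain ⟨v, rfl⟩ := Quot.exists_rep v
    exact congrArg (Quot.mk _) v.map_id
  map_comp θ η := by
    ext v
    obtain ⟨v, rfl⟩ := Quot.exists_rep v
    exact congrArg (Quot.mk _) (v.map_map θ η)

/-- The colimit of `D`, by generators and relations, in levelwise form. -/
def colimLevelwise : Levelwise (ColimOb D) where
  Hom := colimHom D
  one p m := Quot.mk _ (.one p)
  comp {p q r m} v w := Quot.map₂ Word.comp (fun _ _ _ h => .congr (.refl _) h)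
    (fun _ _ _ h => .congr h (.refl _)) v w
  map_one p m m' θ := rfl
  map_comp {p q r m m'} θ v w := by
    obtain ⟨v, rfl⟩ := Quot.exists_rep v
    obtain ⟨w, rfl⟩ := Quot.exists_rep w
    rfl
  one_comp {p q m} v := by
    obtain ⟨v, rfl⟩ := Quot.exists_rep v
    exact Quot.sound (.one_comp v)
  comp_one {p q m} v := by
    obtain ⟨v, rfl⟩ := Quot.exists_rep v
    exact Quot.sound (.comp_one v)
  assoc {p q r s m} u v w := by
    obtain ⟨u, rfl⟩ := Quot.exists_rep u
    obtain ⟨v, rfl⟩ := Quot.exists_rep v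
    obtain ⟨w, rfl⟩ := Quot.exists_rep w
    exact Quot.sound (.assoc u v w)

/-- The colimit of `D`, by generators and relations. -/
noncomputable def colim : SCat :=
  letI := (colimLevelwise D).toEnriched
  { Ob := ColimOb D }

/-- The canonical functor from `D.obj a` to the colimit. -/
noncomputable def colimι (a : A) : D.obj a ⟶ colim D :=
  SCat.mkHom (D := colim D) (fun x => ColimOb.mk D a x)
    (fun {x y m} f => (Quot.mk _ (.gen a x y rfl rfl f) :
      Quot (Rel D (m := m) (p := ColimOb.mk D a x) (q := ColimOb.mk D a y))))
    (fun _ _ => rfl)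
    (fun x m => Quot.sound (.gen_one a x rfl))
    (fun {x y z m} f g => Quot.sound (.gen_comp a x y z rfl rfl rfl f g))

lemma colim_mk_heq {m : SimplexCategoryᵒᵖ} (a : A) (x y : (D.obj a).Ob) {p q p' q' : ColimOb D}
    (hx : ColimOb.mk D a x = p) (hy : ColimOb.mk D a y = q) (hx' : ColimOb.mk D a x = p')
    (hy' : ColimOb.mk D a y = q') (f : ((D.obj a).Map x y).obj m) :
    HEq (Quot.mk (Rel D) (.gen a x y hx hy f)) (Quot.mk (Rel D) (.gen a x y hx' hy' f)) := by
  subst hx hy hx' hy'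
  rfl

/-- The cocone with point `colim D`. -/
noncomputable def colimCocone : Cocone D where
  pt := colim D
  ι :=
    { app := colimι D
      naturality := fun a b u => by
        refine SCat.hom_ext _ _ (fun x => ColimOb.sound D u x) fun x y m f => ?_
        refine HEq.trans (colim_mk_heq D b _ _ rfl rfl
          (ColimOb.sound D u x) (ColimOb.sound D u y) _) (heq_of_eq ?_)
        exact Quot.sound (.gen_map u x y rfl rfl f) }

variable {D} (s : Cocone D)

/-- The map on objects induced by a cocone. -/
def descOb : ColimOb D → s.pt.Ob :=
  Quot.lift (fun p => SCat.fobj (s.ι.app p.1) p.2) (by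
    rintro ⟨a, x⟩ ⟨b, y⟩ ⟨u, h⟩
    dsimp only at u h
    subst h
    rw [← s.w u]
    rfl)

/-- The value of a formal composite in the point of a cocone. -/
def descWord {m : SimplexCategoryᵒᵖ} :
    ∀ {p q : ColimOb D}, Word D m p q → (s.pt.Map (descOb s p) (descOb s q)).obj m
  | _, _, .gen a x y hx hy f => hx ▸ hy ▸ (SCat.fmap (s.ι.app a) x y).app m f
  | _, _, .one p => SCat.one _ m
  | _, _, .comp v w => SCat.comp (descWord v) (descWord w)

lemma descWord_gen {m : SimplexCategoryᵒᵖ} {p q : ColimOb D} (a : A) (x y : (D.obj a).Ob)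
    (hx : ColimOb.mk D a x = p) (hy : ColimOb.mk D a y = q) (f : ((D.obj a).Map x y).obj m) :
    HEq (descWord s (.gen a x y hx hy f)) ((SCat.fmap (s.ι.app a) x y).app m f) := by
  subst hx hy
  rfl

lemma descWord_rel {m : SimplexCategoryᵒᵖ} {p q : ColimOb D} {v w : Word D m p q}
    (h : Rel D v w) : descWord s v = descWord s w := by
  induction h with
  | refl v => rfl
  | symm _ ih => exact ih.symm
  | trans _ _ ih ih' => exact ih.trans ih'
  | congr _ _ ih ih' => simp only [descWord, ih, ih']
  | one_comp v => exact SCat.one_comp _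
  | comp_one v => exact SCat.comp_one _
  | assoc u v w => exact SCat.assoc _ _ _
  | gen_one a x hx =>
    subst hx
    exact SCat.fmap_one _ _ _
  | gen_comp a x y z hx hy hz f g =>
    subst hx hy hz
    exact SCat.fmap_comp _ _ _
  | gen_map u x y hx hy f =>
    refine eq_of_heq ((descWord_gen s _ _ _ _ _ _).trans
      (HEq.trans ?_ (descWord_gen s _ _ _ hx hy f).symm))
    exact SCat.heq_of_eq (s.w u) f

lemma descWord_map {m m' : SimplexCategoryᵒᵖ} (θ : m ⟶ m') {p q : ColimOb D}
    (v : Word D m p q) :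
    descWord s (v.map θ) = (s.pt.Map (descOb s p) (descOb s q)).map θ (descWord s v) := by
  induction v with
  | gen a x y hx hy f =>
    subst hx hy
    exact SCat.fmap_nat _ _ _
  | one p => exact (SCat.map_one θ).symm
  | comp v w ih ih' =>
    simp only [descWord, Word.map, SCat.map_comp, ih, ih']

/-- The functor from the colimit induced by a cocone. -/
noncomputable def colimDesc : colim D ⟶ s.pt :=
  SCat.mkHom (C := colim D) (descOb s)
    (fun {p q m} f => Quot.lift (descWord s) (fun _ _ h => descWord_rel s h) f)
    (fun {p q m m'} θ f => by
      obtain ⟨v, rfl⟩ := Quot.exists_rep f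
      exact descWord_map s θ v)
    (fun _ _ => rfl)
    (fun {p q r m} f g => by
      obtain ⟨v, rfl⟩ := Quot.exists_rep f
      obtain ⟨w, rfl⟩ := Quot.exists_rep g
      rfl)

/-- `colim D` is a colimit of `D`. -/
noncomputable def isColimitColimCocone (D : A ⥤ SCat) : IsColimit (colimCocone D) where
  desc s := colimDesc s
  fac s a := rfl
  uniq s F hF := by
    have hob : ∀ p, SCat.fobj F p = descOb s p := by
      rintro ⟨a, x⟩
      change SCat.fobj ((colimCocone D).ι.app a ≫ F) x = _
      rw [hF a]
      rfl
    refine SCat.hom_ext _ _ hob fun p q m f => ?_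
    obtain ⟨v, rfl⟩ := Quot.exists_rep f
    change HEq ((SCat.fmap F p q).app m (Quot.mk (Rel D) v)) (descWord s v)
    induction v with
    | gen a x y hx hy f =>
      subst hx hy
      exact SCat.heq_of_eq (hF a) f
    | one p =>
      refine (heq_of_eq (SCat.fmap_one F p m)).trans ?_
      change HEq (SCat.one _ m) (SCat.one _ m)
      rw [hob p]
    | comp v w ih ih' =>
      refine (heq_of_eq (SCat.fmap_comp (C := colim D) F
        (Quot.mk (Rel D) v) (Quot.mk (Rel D) w))).trans ?_
      exact SCat.comp_heq (hob _) (hob _) (hob _) ih ih'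

/-- `sCat` has all small colimits. -/
instance : HasColimitsOfSize.{0, 0} SCat where
  has_colimits_of_shape _ _ := ⟨fun D => ⟨⟨_, isColimitColimCocone D⟩⟩⟩

end Colimits


/-- The functor `𝚫_𝔑 : sSet ⥤ sCat`: the colimit-preserving extension (left Kan extension)
of `[n] ↦ 𝚫_𝔑ⁿ` along the Yoneda embedding `[n] ↦ Δⁿ`. -/
noncomputable def thickening : SSet.{0} ⥤ SCat :=
  (uliftYoneda.{0} : SimplexCategory ⥤ SimplexCategoryᵒᵖ ⥤ Type).leftKanExtension
    thickCosimplicial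

/-- `𝚫_𝔑(Δⁿ) ≅ 𝚫_𝔑ⁿ`, naturally in `[n]`. -/
noncomputable def thickeningSimplex : SSet.stdSimplex.{0} ⋙ thickening ≅ thickCosimplicial :=
  Presheaf.isExtensionAlongULiftYoneda.{0} thickCosimplicial

/-- `𝚫_𝔑` commutes with colimits. -/
instance : PreservesColimitsOfSize.{0, 0} thickening :=
  Presheaf.preservesColimitsOfSize_leftKanExtension.{0} thickCosimplicial

/-- The category `π₀(C)`: the objects are those of `C` and the sets of maps are the sets of
connected components of the simplicial sets of maps of `C`. -/
structure PiZero (C : SCat) where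
  as : C.Ob

lemma SCat.pi_sound {C : SCat} {x y z : C.Ob} {f f' : (C.Map x y).obj (op (.mk 0))}
    {g g' : (C.Map y z).obj (op (.mk 0))} (e : (C.Map x y).Edge f f')
    (e' : (C.Map y z).Edge g g') :
    SSet.π₀.mk (SCat.comp f g) = SSet.π₀.mk (SCat.comp f' g') := by
  refine SSet.π₀.sound (SSet.Edge.mk (SCat.comp e.edge e'.edge) ?_ ?_)
  · refine (SCat.map_comp _ e.edge e'.edge).trans ?_
    exact congrArg₂ SCat.comp e.src_eq e'.src_eq
  · refine (SCat.map_comp _ e.edge e'.edge).trans ?_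
    exact congrArg₂ SCat.comp e.tgt_eq e'.tgt_eq

instance instCategoryPiZero (C : SCat) : Category (PiZero C) where
  Hom x y := (C.Map x.as y.as).π₀
  id x := SSet.π₀.mk (SCat.one x.as (op (.mk 0)))
  comp {x y z} f g := SSet.π₀.lift
    (fun f₀ => SSet.π₀.lift (fun g₀ => SSet.π₀.mk (SCat.comp f₀ g₀))
      (fun _ _ e => SCat.pi_sound (SSet.Edge.id f₀) e) g)
    (fun _ _ e => by
      obtain ⟨g₀, rfl⟩ := g.mk_surjective
      exact SCat.pi_sound e (SSet.Edge.id g₀)) f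
  id_comp f := by
    obtain ⟨f, rfl⟩ := SSet.π₀.mk_surjective f
    exact congrArg SSet.π₀.mk (SCat.one_comp f)
  comp_id f := by
    obtain ⟨f, rfl⟩ := SSet.π₀.mk_surjective f
    exact congrArg SSet.π₀.mk (SCat.comp_one f)
  assoc f g h := by
    obtain ⟨f, rfl⟩ := SSet.π₀.mk_surjective f
    obtain ⟨g, rfl⟩ := SSet.π₀.mk_surjective g
    obtain ⟨h, rfl⟩ := SSet.π₀.mk_surjective h
    exact congrArg SSet.π₀.mk (SCat.assoc f g h)

/-- The functor `π₀(F)`. -/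
def piZeroMap {C D : SCat} (F : C ⟶ D) : PiZero C ⥤ PiZero D where
  obj x := ⟨SCat.fobj F x.as⟩
  map {x y} f := SSet.mapπ₀ (SCat.fmap F x.as y.as) f
  map_id x := congrArg SSet.π₀.mk (SCat.fmap_one F x.as _)
  map_comp f g := by
    obtain ⟨f, rfl⟩ := SSet.π₀.mk_surjective f
    obtain ⟨g, rfl⟩ := SSet.π₀.mk_surjective g
    exact congrArg SSet.π₀.mk (SCat.fmap_comp F f g)

/-- Homotopy classes of maps of simplicial sets (classes of the equivalence relation generated
by simplicial homotopy). -/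
def HoClass (X K : SSet.{0}) : Type :=
  Quot fun f g : X ⟶ K => Nonempty (SSet.Homotopy f g)

/-- Precomposition with `f` on homotopy classes. -/
def HoClass.precomp {X Y : SSet.{0}} (f : X ⟶ Y) (K : SSet.{0}) : HoClass Y K → HoClass X K :=
  Quot.map (fun g => f ≫ g) (by
    rintro g g' ⟨h⟩
    exact ⟨SSet.RelativeMorphism.Homotopy.precomp h (SSet.RelativeMorphism.botEquiv.symm f)
      (SSet.Subcomplex.isInitialBot.hom_ext _ _)⟩)

/-- `f` is a weak (homotopy) equivalence of simplicial sets: for every Kan complex `K` it induces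
a bijection from homotopy classes of maps `Y ⟶ K` to homotopy classes of maps `X ⟶ K`. -/
def IsWeakHomotopyEquiv {X Y : SSet.{0}} (f : X ⟶ Y) : Prop :=
  ∀ (K : SSet.{0}) [SSet.KanComplex K], Function.Bijective (HoClass.precomp f K)

/-- Weak equivalences of simplicial categories: `π₀(F)` induces a homotopy equivalence of nerves,
and `F` induces weak equivalences of simplicial sets of maps. -/
structure IsWeakEquivalence {C D : SCat} (F : C ⟶ D) : Prop where
  nerve_piZero : IsWeakHomotopyEquiv (nerveMap (piZeroMap F))
  map (x y : C.Ob) : IsWeakHomotopyEquiv (SCat.fmap F x y)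

/-- Strong equivalences: weak equivalences `F` such that `π₀(F)` is an equivalence of categories. -/
structure IsStrongEquivalence {C D : SCat} (F : C ⟶ D) : Prop extends IsWeakEquivalence F where
  piZero : (piZeroMap F).IsEquivalence

/-- The generating cofibrations of `sCat`: the functor `∅ → *`, and the functors `K₀₁ → L₀₁` for
all cofibrations (monomorphisms) `K ⟶ L` of simplicial sets. -/
inductive generatingCofibrations : MorphismProperty SCat
  | empty : generatingCofibrations emptyToPt
  | arrow {K L : SSet.{0}} (i : K ⟶ L) [Mono i] : generatingCofibrations (arrowMap i)

/-- The cofibrations of `sCat`, generated by the above: the functors with the left lifting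
property against all functors with the right lifting property against the generators. -/
def cofibrations : MorphismProperty SCat := generatingCofibrations.rlp.llp

/-- A strong acyclic cofibration: a cofibration that is a strong equivalence. -/
def IsStrongAcyclicCofibration {C D : SCat} (F : C ⟶ D) : Prop :=
  cofibrations F ∧ IsStrongEquivalence F

/-- The map `𝚫_𝔑(Λⁿᵢ) → 𝚫_𝔑(Δⁿ) ≅ 𝚫_𝔑ⁿ` induced by the inclusion of the horn. -/
noncomputable def hornMap (n : ℕ) (i : Fin (n + 1)) :
    thickening.obj (SSet.horn n i).toSSet ⟶ thick (Fin (n + 1)) :=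
  thickening.map (SSet.horn n i).ι ≫ thickeningSimplex.hom.app (SimplexCategory.mk n)

end CohNerve

/-! The thickening of the inner horn is the simplicial subcategory of `𝚫_𝔑ⁿ` generated by the faces
of the horn, and this subcategory is explicit. Since `0` and `n` both differ from `i`, a simplex of
`I^{(a,b)}` with `(a,b) ≠ (0,n)` already lies in a face of the horn. Only `I^{(0,n)}` can shrink.
There, omitting a vertex `j ≠ i` gives the face `x_j = 1`, and composites through `c` give the face
`x_c = 0`; together these form the open box, the union of all faces of the cube but `x_i = 1`.

Identification (`hornIso`). A functor out of `𝚫_𝔑(Λⁿᵢ)` is a compatible family of functors on the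
simplices of the horn (`thickeningDesc`, `thickening_hom_ext`). Such a family extends uniquely to
the subcategory. On a simplex lying in a face the value is forced, and independent of the
presentation because every presentation can be compared with one given by a monotone retraction
(`HornFamily.exists_isValue`). On a simplex with a coordinate constantly `0` the value is the
composite of the values at its two parts, and associativity makes it independent of the cut
(`HornFamily.cutValue_eq`).

Cofibration (`cofibrations_boxι`). A lifting problem is solved separately on each simplicial set of
maps, against the monomorphism from box to cube. The lifts form a functor because every composite of
two nontrivial maps is in the box, where the lift is prescribed.

Strong equivalence. Multiplying the coordinate `x_i` by a parameter contracts both the cube and the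
open box onto the face `x_i = 0` (`boxContraction`, `cubeContraction`). So the inclusion is a
homotopy equivalence on maps; being the identity on objects, it induces an isomorphism on `π₀`,
which settles the conditions on the nerve and on equivalence of categories. -/

open CategoryTheory MonoidalCategory Opposite Limits

namespace CohNerve

/-! ### Functors out of `𝚫_𝔑(X)` as compatible families indexed by the simplices of `X`. -/

section SimplicesOfThickening

variable {X Y : SSet.{0}} {E : SCat}

/-- The natural map `𝚫_𝔑ᵏ ⟶ 𝚫_𝔑(Δᵏ)` exhibiting `𝚫_𝔑` as a left Kan extension. -/
noncomputable def thickeningUnit :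
    thickCosimplicial ⟶
      (uliftYoneda.{0} : SimplexCategory ⥤ SimplexCategoryᵒᵖ ⥤ Type) ⋙ thickening :=
  (uliftYoneda.{0} : SimplexCategory ⥤ SimplexCategoryᵒᵖ ⥤ Type).leftKanExtensionUnit
    thickCosimplicial

instance : thickening.IsLeftKanExtension thickeningUnit :=
  inferInstanceAs (((uliftYoneda.{0} :
    SimplexCategory ⥤ SimplexCategoryᵒᵖ ⥤ Type).leftKanExtension
      thickCosimplicial).IsLeftKanExtension ((uliftYoneda.{0} :
        SimplexCategory ⥤ SimplexCategoryᵒᵖ ⥤ Type).leftKanExtensionUnit thickCosimplicial))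

/-- `𝚫_𝔑` is left adjoint to the coherent nerve. -/
noncomputable def thickeningAdj :
    thickening ⊣ Presheaf.restrictedULiftYoneda.{0} thickCosimplicial :=
  Presheaf.uliftYonedaAdjunction.{0} thickening thickeningUnit

/-- The functor `𝚫_𝔑ᵏ ⟶ 𝚫_𝔑(X)` given by a `k`-simplex of `X`. -/
noncomputable def simplexFunctor {k : SimplexCategory} (x : X.obj (op k)) :
    thickCosimplicial.obj k ⟶ thickening.obj X :=
  thickeningUnit.app k ≫ thickening.map (uliftYonedaEquiv.symm x)

lemma thickeningAdj_homEquiv_app (F : thickening.obj X ⟶ E) {k : SimplexCategory}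
    (x : X.obj (op k)) :
    ((thickeningAdj.homEquiv X E F).app (op k) x) = ULift.up (simplexFunctor x ≫ F) := by
  have := Presheaf.uliftYonedaAdjunction_homEquiv_app.{0} thickening thickeningUnit F x
  rw [simplexFunctor, Category.assoc]
  exact this

/-- By adjunction `F` is a map from `X` to the coherent nerve of `E`, whose value at `x` is the
restriction of `F` along `simplexFunctor x`. -/
lemma thickening_hom_ext {F G : thickening.obj X ⟶ E}
    (h : ∀ (k : SimplexCategory) (x : X.obj (op k)), simplexFunctor x ≫ F = simplexFunctor x ≫ G) :
    F = G := by
  apply (thickeningAdj.homEquiv X E).injective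
  ext k x
  induction k using Opposite.rec with | _ k
  refine (thickeningAdj_homEquiv_app F x).trans (Eq.trans ?_ (thickeningAdj_homEquiv_app G x).symm)
  rw [h]

/-- This is the naturality of the adjunct of the identity of `𝚫_𝔑(X)`. -/
lemma thickMap_simplexFunctor {k l : SimplexCategory} (θ : k ⟶ l) (x : X.obj (op l)) :
    thickCosimplicial.map θ ≫ simplexFunctor x = simplexFunctor (X.map θ.op x) := by
  have := ConcreteCategory.congr_hom
    ((thickeningAdj.homEquiv X _ (𝟙 (thickening.obj X))).naturality θ.op) x
  have h1 := (thickeningAdj_homEquiv_app (𝟙 (thickening.obj X)) (X.map θ.op x)).symm.trans this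
  have h2 := congrArg (fun z => ((Presheaf.restrictedULiftYoneda.{0} thickCosimplicial).obj
    (thickening.obj X)).map θ.op z) (thickeningAdj_homEquiv_app (𝟙 (thickening.obj X)) x)
  have h3 := congrArg ULift.down (h1.trans h2)
  rw [Category.comp_id, Category.comp_id] at h3
  exact h3.symm

lemma simplexFunctor_map (f : X ⟶ Y) {k : SimplexCategory} (x : X.obj (op k)) :
    simplexFunctor x ≫ thickening.map f = simplexFunctor (f.app _ x) := by
  have := congr_app (thickeningAdj.homEquiv_naturality_left f (𝟙 (thickening.obj Y))) (op k)
  have h1 := (thickeningAdj_homEquiv_app _ x).symm.trans (ConcreteCategory.congr_hom this x)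
  have h3 := congrArg ULift.down
    (h1.trans (thickeningAdj_homEquiv_app (𝟙 (thickening.obj Y)) (f.app _ x)))
  rw [Category.comp_id, Category.comp_id] at h3
  exact h3

/-- By the Yoneda lemma `x` is the restriction of the universal simplex `u` of `Δⁿ`. The functor of
`u` is the unit of the Kan extension, which `thickeningSimplex` inverts. -/
lemma simplexFunctor_thickeningSimplex {n k : SimplexCategory}
    (x : (uliftYoneda.{0}.obj n).obj (op k)) :
    simplexFunctor x ≫ thickeningSimplex.hom.app n = thickCosimplicial.map (ULift.down x) := by
  obtain ⟨u, hu, hux⟩ : ∃ u : (uliftYoneda.{0}.obj n).obj (op n),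
      uliftYonedaEquiv.symm u = 𝟙 (uliftYoneda.{0}.obj n) ∧
        (uliftYoneda.{0}.obj n).map (Quiver.Hom.op (ULift.down x)) u = x :=
    ⟨uliftYonedaEquiv (𝟙 _), Equiv.symm_apply_apply _ _,
      congrArg ULift.up (Category.comp_id (ULift.down x))⟩
  obtain ⟨e, he, hue⟩ : ∃ e : thickening.obj (uliftYoneda.{0}.obj n) ⟶ thickCosimplicial.obj n,
      e = thickeningSimplex.hom.app n ∧ thickeningUnit.app n ≫ e = 𝟙 _ :=
    ⟨_, rfl, thickeningSimplex.inv_hom_id_app n⟩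
  have h2 := thickMap_simplexFunctor (ULift.down x) u
  rw [hux] at h2
  have h3 : simplexFunctor u = thickeningUnit.app n := by
    rw [simplexFunctor, hu, thickening.map_id]
    exact Category.comp_id _
  refine (congrArg (simplexFunctor x ≫ ·) he.symm).trans ?_
  dsimp only
  rw [← h2, Category.assoc, h3, hue, Category.comp_id]

lemma simplexFunctor_hornMap {n : ℕ} {i : Fin (n + 1)} {k : SimplexCategory}
    (x : (SSet.horn.{0} n i).toSSet.obj (op k)) :
    simplexFunctor x ≫ hornMap n i = thickMap (SSet.stdSimplex.asOrderHom x.1) := by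
  refine (Category.assoc _ _ _).symm.trans ?_
  rw [simplexFunctor_map]
  exact simplexFunctor_thickeningSimplex _

/-- The functor `𝚫_𝔑(X) ⟶ E` given by a compatible family of functors `𝚫_𝔑ᵏ ⟶ E`. -/
noncomputable def thickeningDesc
    (F : ∀ (k : SimplexCategory), X.obj (op k) → (thickCosimplicial.obj k ⟶ E))
    (hF : ∀ {k l : SimplexCategory} (θ : k ⟶ l) (x : X.obj (op l)),
      F k (X.map θ.op x) = thickCosimplicial.map θ ≫ F l x) :
    thickening.obj X ⟶ E :=
  (thickeningAdj.homEquiv X E).symm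
    { app k := ↾fun x => ULift.up (F k.unop x)
      naturality k l θ := by
        ext x
        exact congrArg ULift.up (hF θ.unop x) }

lemma simplexFunctor_thickeningDesc
    (F : ∀ (k : SimplexCategory), X.obj (op k) → (thickCosimplicial.obj k ⟶ E))
    (hF : ∀ {k l : SimplexCategory} (θ : k ⟶ l) (x : X.obj (op l)),
      F k (X.map θ.op x) = thickCosimplicial.map θ ≫ F l x)
    {k : SimplexCategory} (x : X.obj (op k)) :
    simplexFunctor x ≫ thickeningDesc F hF = F k x := by
  have := thickeningAdj_homEquiv_app (thickeningDesc F hF) x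
  rw [thickeningDesc, Equiv.apply_symm_apply] at this
  exact (congrArg ULift.down this).symm

end SimplicesOfThickening

/-! ### Simplices of cubes: cutting at a vertex, omitting a vertex, and the action of monotone maps.
-/

namespace Cube

variable {J K : Type} [LinearOrder J] [LinearOrder K] {a b c : J} {m m' : SimplexCategoryᵒᵖ}

/-- The simplicial operators on simplices of `I^{(a,b)}`. -/
def res (θ : m ⟶ m') (f : Cube a b m) : Cube a b m' :=
  ⟨f.le, fun x => (f.coord x).comp θ.unop.toOrderHom⟩

/-- The composition of simplices in `thick J`. -/
def comp (f : Cube a b m) (g : Cube b c m) : Cube a c m :=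
  ⟨f.le.trans g.le, fun x =>
    if h : x.1 < b then f.coord ⟨x.1, x.2.1, h⟩
    else if h' : b < x.1 then g.coord ⟨x.1, h', x.2.2⟩
    else OrderHom.const _ 0⟩

/-- The action of `thickMap φ` on simplices. -/
noncomputable def push (φ : J →o K) (f : Cube a b m) : Cube (φ a) (φ b) m :=
  (SCat.fmap (thickMap φ) a b).app m f

lemma push_coord (φ : J →o K) (f : Cube a b m) (y : Set.Ioo (φ a) (φ b)) :
    (push φ f).coord y =
      ⨅ x : {x : Set.Ioo (α := J) a b // φ x.1 = y.1}, f.coord x.1 := rfl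

lemma push_res (φ : J →o K) (θ : m ⟶ m') (f : Cube a b m) :
    push φ (f.res θ) = (push φ f).res θ :=
  SCat.fmap_nat (thickMap φ) θ f

lemma push_comp (φ : J →o K) (f : Cube a b m) (g : Cube b c m) :
    push φ (f.comp g) = (push φ f).comp (push φ g) :=
  SCat.fmap_comp (thickMap φ) f g

/-- `f` is constant in the direction `c`, and divides there as a composite. -/
def Cuts (f : Cube a b m) (c : J) : Prop :=
  ∃ h : c ∈ Set.Ioo a b, f.coord ⟨c, h⟩ = OrderHom.const _ 0

/-- `f` comes from `thick` of a subset of `J` that does not contain `x`. -/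
def Omits (f : Cube a b m) (x : J) : Prop :=
  x ≠ a ∧ x ≠ b ∧ ∀ h : x ∈ Set.Ioo a b, f.coord ⟨x, h⟩ = OrderHom.const _ 1

/-- The part of `f` before `c`. -/
def left (f : Cube a b m) (c : J) (hac : a ≤ c) (hcb : c ≤ b) : Cube a c m :=
  ⟨hac, fun x => f.coord ⟨x.1, x.2.1, x.2.2.trans_le hcb⟩⟩

/-- The part of `f` after `c`. -/
def right (f : Cube a b m) (c : J) (hac : a ≤ c) (hcb : c ≤ b) : Cube c b m :=
  ⟨hcb, fun x => f.coord ⟨x.1, hac.trans_lt x.2.1, x.2.2⟩⟩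

lemma const_zero_ne_one : (OrderHom.const (Fin (m.unop.len + 1)) (0 : Fin 2)) ≠
    OrderHom.const _ 1 := fun h => by
  have := congrArg (fun f : Fin (m.unop.len + 1) →o Fin 2 => f 0) h
  simp at this

lemma eq_const_one_of_le {f g : Fin (m.unop.len + 1) →o Fin 2} (h : f = OrderHom.const _ 1)
    (hfg : f ≤ g) : g = OrderHom.const _ 1 := by
  subst h
  exact le_antisymm (fun _ => Fin.le_last _) hfg

instance : Subsingleton (Cube a a m) :=
  ⟨fun _ _ => Cube.ext (funext fun x => absurd (x.2.1.trans x.2.2) (lt_irrefl _))⟩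

lemma Cuts.left_comp_right {f : Cube a b m} (h : f.Cuts c) :
    (f.left c h.1.1.le h.1.2.le).comp (f.right c h.1.1.le h.1.2.le) = f := by
  obtain ⟨hc, hf⟩ := h
  refine Cube.ext (funext fun x => ?_)
  change dite _ _ _ = _
  split_ifs with h1 h2
  · rfl
  · rfl
  · obtain rfl : c = x.1 := le_antisymm (not_lt.1 h1) (not_lt.1 h2)
    exact hf.symm

lemma cuts_comp (f : Cube a b m) (g : Cube b c m) (hab : a < b) (hbc : b < c) :
    (f.comp g).Cuts b := by
  refine ⟨⟨hab, hbc⟩, ?_⟩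
  change dite _ _ _ = _
  simp

lemma left_comp (f : Cube a b m) (g : Cube b c m) : (f.comp g).left b f.le g.le = f := by
  refine Cube.ext (funext fun x => ?_)
  change dite _ _ _ = _
  simp [x.2.2]

lemma right_comp (f : Cube a b m) (g : Cube b c m) : (f.comp g).right b f.le g.le = g := by
  refine Cube.ext (funext fun x => ?_)
  change dite _ _ _ = _
  simp [x.2.1, x.2.1.le]

lemma Cuts.res {f : Cube a b m} (h : f.Cuts c) (θ : m ⟶ m') : (f.res θ).Cuts c := by
  obtain ⟨hc, hf⟩ := h
  refine ⟨hc, ?_⟩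
  change (f.coord _).comp _ = _
  rw [hf]
  rfl

lemma Omits.res {f : Cube a b m} {x : J} (h : f.Omits x) (θ : m ⟶ m') : (f.res θ).Omits x := by
  refine ⟨h.1, h.2.1, fun hx => ?_⟩
  change (f.coord _).comp _ = _
  rw [h.2.2 hx]
  rfl

/-- Composition inserts `0` at the middle object, whereas an omitted interior vertex carries the
coordinate `1`. -/
lemma Omits.ne_of_comp {f : Cube a b m} {g : Cube b c m} {x : J} (h : (f.comp g).Omits x) :
    x ≠ b := by
  rintro rfl
  have hax : a < x := lt_of_le_of_ne f.le h.1.symm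
  have hxc : x < c := lt_of_le_of_ne g.le h.2.1
  have := (cuts_comp f g hax hxc).2
  rw [h.2.2 ⟨hax, hxc⟩] at this
  exact const_zero_ne_one this.symm

lemma Omits.of_comp_left {f : Cube a b m} {g : Cube b c m} {x : J} (h : (f.comp g).Omits x) :
    f.Omits x := by
  refine ⟨h.1, h.ne_of_comp, fun hx => ?_⟩
  have := h.2.2 ⟨hx.1, hx.2.trans_le g.le⟩
  change dite _ _ _ = _ at this
  simpa [hx.2] using this

lemma Omits.of_comp_right {f : Cube a b m} {g : Cube b c m} {x : J} (h : (f.comp g).Omits x) :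
    g.Omits x := by
  refine ⟨h.ne_of_comp, h.2.1, fun hx => ?_⟩
  have := h.2.2 ⟨f.le.trans_lt hx.1, hx.2⟩
  change dite _ _ _ = _ at this
  simpa [hx.1, not_lt.2 hx.1.le] using this

/-- The coordinate of `push φ f` at `φ x` is an infimum in which the coordinate of `f` at `x` takes
part; if the infimum is `1`, so is each term. Contrapositively, `φ` sends the vertices that `f` uses
to vertices that `push φ f` uses. -/
lemma Omits.of_push {φ : J →o K} {f : Cube a b m} {x : J} (h : (push φ f).Omits (φ x)) :
    f.Omits x := by
  refine ⟨fun e => h.1 (by rw [e]), fun e => h.2.1 (by rw [e]), fun hx => ?_⟩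
  have h1 : φ a < φ x := lt_of_le_of_ne (φ.monotone hx.1.le) h.1.symm
  have h2 : φ x < φ b := lt_of_le_of_ne (φ.monotone hx.2.le) h.2.1
  refine eq_const_one_of_le (h.2.2 ⟨h1, h2⟩) ?_
  rw [push_coord]
  exact iInf_le (fun y : {y : Set.Ioo (α := J) a b // φ y.1 = φ x} => f.coord y.1) ⟨⟨x, hx⟩, rfl⟩

/-- The infimum over an empty fibre is `1`. -/
lemma push_omits (φ : J →o K) (f : Cube a b m) {y : K} (hy : ∀ x, φ x ≠ y) :
    (push φ f).Omits y := by
  refine ⟨(hy a).symm, (hy b).symm, fun h => ?_⟩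
  rw [push_coord]
  exact le_antisymm (fun _ => Fin.le_last _) (le_iInf fun x => absurd x.2 (hy _))

/-- A monotone map that fixes the elements of a subset induces a functor that fixes the simplices
coming from that subset. -/
lemma push_heq_self (ρ : J →o J) (T : Set J) (hT : ∀ x ∈ T, ρ x = x)
    (f : Cube a b m) (hf : ∀ x ∉ T, f.Omits x) : HEq (push ρ f) f := by
  have ha : ρ a = a := hT _ (by by_contra h; exact (hf _ h).1 rfl)
  have hb : ρ b = b := hT _ (by by_contra h; exact (hf _ h).2.1 rfl)
  -- Only points of `T` matter in the infimum over the fibre of `y`: the other points carry the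
  -- coordinate `1`, and the only point of `T` that can lie in the fibre is `y`.
  have key : ∀ y (h1 : y ∈ Set.Ioo (ρ a) (ρ b)) (h2 : y ∈ Set.Ioo a b),
      (push ρ f).coord ⟨y, h1⟩ = f.coord ⟨y, h2⟩ := by
    intro y h1 h2
    rw [push_coord]
    apply le_antisymm
    · by_cases hy : y ∈ T
      · exact iInf_le (fun x : {x : Set.Ioo (α := J) a b // ρ x.1 = y} => f.coord x.1)
          ⟨⟨y, h2⟩, hT y hy⟩
      · rw [(hf y hy).2.2 h2]
        exact fun _ => Fin.le_last _
    · refine le_iInf fun x => ?_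
      by_cases hx : x.1.1 ∈ T
      · have hxy : x.1.1 = y := (hT _ hx).symm.trans x.2
        refine le_of_eq ?_
        congr 1
        exact Subtype.ext hxy.symm
      · rw [(hf _ hx).2.2 x.1.2]
        exact fun _ => Fin.le_last _
  generalize push ρ f = g at key
  generalize ρ a = a' at *
  generalize ρ b = b' at *
  subst ha hb
  exact heq_of_eq (Cube.ext (funext fun y => key y.1 y.2 y.2))

end Cube

/-- Every nonempty subset of a finite linear order is the image of a monotone retraction. -/
lemma exists_retraction {k : ℕ} (T : Set (Fin (k + 1))) (hT : T.Nonempty) :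
    ∃ ρ : Fin (k + 1) →o Fin (k + 1), (∀ x, ρ x ∈ T) ∧ ∀ x ∈ T, ρ x = x := by
  obtain ⟨b, hb, hmax⟩ := T.toFinite.exists_maximal hT
  have hle : ∀ t ∈ T, t ≤ b := fun t ht => (le_total t b).elim id fun h => hmax ht h
  have hne : ∀ x, {t | t ∈ T ∧ min x b ≤ t}.Nonempty := fun x => ⟨b, hb, min_le_right _ _⟩
  -- The retraction sends `x` to the least element of `T` above `x`, or to the greatest element `b`
  -- of `T` if there is none; the truncation `min x b` covers both cases.
  refine ⟨⟨fun x => sInf {t | t ∈ T ∧ min x b ≤ t}, fun x y hxy => ?_⟩, fun x => ?_, fun x hx => ?_⟩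
  · have := csInf_mem (hne y)
    exact csInf_le' ⟨this.1, (min_le_min_right b hxy).trans this.2⟩
  · exact (csInf_mem (hne x)).1
  · change sInf {t | t ∈ T ∧ min x b ≤ t} = x
    refine le_antisymm (csInf_le' ⟨hx, min_le_left _ _⟩) ?_
    have := (csInf_mem (hne x)).2
    exact (min_eq_left (hle x hx)).symm.le.trans this

section

/-! ### Simplices of maps between objects that are equal, but not by definition. -/

section HEqLemmas

variable {C D E : SCat} {m m' : SimplexCategoryᵒᵖ}

lemma SCat.map_heq {x y x' y' : C.Ob} (hx : x = x') (hy : y = y') {f : (C.Map x y).obj m}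
    {f' : (C.Map x' y').obj m} (hf : HEq f f') (θ : m ⟶ m') :
    HEq ((C.Map x y).map θ f) ((C.Map x' y').map θ f') := by
  subst hx hy
  rw [eq_of_heq hf]

lemma SCat.one_heq {x x' : C.Ob} (hx : x = x') : HEq (SCat.one x m) (SCat.one x' m) := by
  subst hx
  rfl

lemma SCat.fmap_heq (F : C ⟶ D) {x y x' y' : C.Ob} (hx : x = x') (hy : y = y')
    {f : (C.Map x y).obj m} {f' : (C.Map x' y').obj m} (hf : HEq f f') :
    HEq ((SCat.fmap F x y).app m f) ((SCat.fmap F x' y').app m f') := by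
  subst hx hy
  rw [eq_of_heq hf]

lemma SCat.fobj_eq_of_eq {F G : C ⟶ D} (h : F = G) (x : C.Ob) : SCat.fobj F x = SCat.fobj G x := by
  rw [h]

end HEqLemmas

variable {n : ℕ} {i : Fin (n + 1)} {m m' : SimplexCategoryᵒᵖ}

/-- A monotone map to `{0,…,n}` that, as a simplex of `Δⁿ`, lies in the `i`-th horn. -/
def InHorn (i : Fin (n + 1)) {k : ℕ} (σ : Fin (k + 1) →o Fin (n + 1)) : Prop :=
  ∃ j, j ≠ i ∧ ∀ x, σ x ≠ j

lemma InHorn.comp {k l : ℕ} {σ : Fin (l + 1) →o Fin (n + 1)} (h : InHorn i σ)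
    (τ : Fin (k + 1) →o Fin (l + 1)) : InHorn i (σ.comp τ) := by
  obtain ⟨j, hj, h⟩ := h
  exact ⟨j, hj, fun x => h _⟩

/-- A vertex misses `0` or `n`, and both differ from `i`: the horn is inner. -/
lemma inHorn_const (hi : 0 < i ∧ i < Fin.last n) {k : ℕ} (x : Fin (n + 1)) :
    InHorn i (OrderHom.const (Fin (k + 1)) x) := by
  by_cases h : x = 0
  · exact ⟨Fin.last n, hi.2.ne', fun _ => by
      subst h
      exact (hi.1.trans hi.2).ne⟩
  · exact ⟨0, hi.1.ne, fun _ => h⟩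

/-! ### The simplices of the subcategory generated by the horn. -/

namespace Cube

variable {a b c : Fin (n + 1)}

/-- `f` comes from a face of the `i`-th horn. -/
def Small (i : Fin (n + 1)) (f : Cube a b m) : Prop := ∃ j, j ≠ i ∧ f.Omits j

/-- `f` is a map of the simplicial subcategory of `𝚫_𝔑ⁿ` generated by the `i`-th horn. -/
def InBox (i : Fin (n + 1)) (f : Cube a b m) : Prop := f.Small i ∨ ∃ c, f.Cuts c

/-- A simplex starting after `0` omits the vertex `0`, which differs from `i`. With the dual
statement for the last vertex, only the maps from `0` to `n` can fail to be small. -/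
lemma small_of_ne_zero (hi : 0 < i ∧ i < Fin.last n) (f : Cube a b m) (ha : a ≠ 0) :
    f.Small i :=
  ⟨0, hi.1.ne, ha.symm, ((Fin.pos_iff_ne_zero.2 ha).trans_le f.le).ne,
    fun h => absurd h.1 (not_lt.2 (Fin.zero_le _))⟩

lemma small_of_ne_last (hi : 0 < i ∧ i < Fin.last n) (f : Cube a b m) (hb : b ≠ Fin.last n) :
    f.Small i :=
  ⟨Fin.last n, hi.2.ne', (f.le.trans_lt (Fin.lt_last_iff_ne_last.2 hb)).ne', hb.symm,
    fun h => absurd h.2 (not_lt.2 (Fin.le_last _))⟩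

lemma Cuts.small_left (hi : 0 < i ∧ i < Fin.last n) {f : Cube a b m} (h : f.Cuts c) :
    (f.left c h.1.1.le h.1.2.le).Small i :=
  small_of_ne_last hi _ (h.1.2.trans_le (Fin.le_last _)).ne

lemma Cuts.small_right (hi : 0 < i ∧ i < Fin.last n) {f : Cube a b m} (h : f.Cuts c) :
    (f.right c h.1.1.le h.1.2.le).Small i :=
  small_of_ne_zero hi _ ((Fin.zero_le _).trans_lt h.1.1).ne'

lemma Small.res {f : Cube a b m} (h : f.Small i) (θ : m ⟶ m') : (f.res θ).Small i := by
  obtain ⟨j, hj, h⟩ := h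
  exact ⟨j, hj, h.res θ⟩

lemma InBox.res {f : Cube a b m} (h : f.InBox i) (θ : m ⟶ m') : (f.res θ).InBox i :=
  h.imp (fun h => h.res θ) (fun ⟨c, h⟩ => ⟨c, h.res θ⟩)

lemma Small.of_comp_left {f : Cube a b m} {g : Cube b c m} (h : (f.comp g).Small i) :
    f.Small i := by
  obtain ⟨j, hj, h⟩ := h
  exact ⟨j, hj, h.of_comp_left⟩

lemma Small.of_comp_right {f : Cube a b m} {g : Cube b c m} (h : (f.comp g).Small i) :
    g.Small i := by
  obtain ⟨j, hj, h⟩ := h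
  exact ⟨j, hj, h.of_comp_right⟩

lemma small_push {k : ℕ} {σ : Fin (k + 1) →o Fin (n + 1)} (hσ : InHorn i σ) {a b : Fin (k + 1)}
    (f : Cube a b m) : (push σ f).Small i := by
  obtain ⟨j, hj, h⟩ := hσ
  exact ⟨j, hj, push_omits σ f h⟩

lemma comp_of_eq_left (f : Cube a a m) (g : Cube a c m) : f.comp g = g := by
  rw [Subsingleton.elim f (SCat.one (C := thick (Fin (n + 1))) a m)]
  exact SCat.one_comp (C := thick (Fin (n + 1))) g

lemma comp_of_eq_right (f : Cube a c m) (g : Cube c c m) : f.comp g = f := by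
  rw [Subsingleton.elim g (SCat.one (C := thick (Fin (n + 1))) c m)]
  exact SCat.comp_one (C := thick (Fin (n + 1))) f

/-- A composite of two maps between distinct objects has a coordinate `0` at the middle object,
whatever the factors are; the other cases are composites with identities. -/
lemma InBox.comp {f : Cube a b m} {g : Cube b c m} (hf : f.InBox i) (hg : g.InBox i) :
    (f.comp g).InBox i := by
  rcases f.le.eq_or_lt with rfl | hab
  · rwa [comp_of_eq_left]
  rcases g.le.eq_or_lt with rfl | hbc
  · rwa [comp_of_eq_right]
  exact Or.inr ⟨b, cuts_comp f g hab hbc⟩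

lemma inBox_one (hi : 0 < i ∧ i < Fin.last n) (f : Cube a a m) : f.InBox i := by
  by_cases h : a = 0
  · exact Or.inl (small_of_ne_last hi f (by rw [h]; exact (hi.1.trans hi.2).ne))
  · exact Or.inl (small_of_ne_zero hi f h)

/-- A small simplex is fixed, together with its factors, by a retraction onto a face. -/
lemma Small.exists_retraction {f : Cube a b m} (h : f.Small i) :
    ∃ ρ : Fin (n + 1) →o Fin (n + 1), InHorn i ρ ∧ (∀ x, ¬ f.Omits (ρ x)) ∧
      ∀ x, ¬ f.Omits x → ρ x = x := by
  obtain ⟨ρ, h1, h2⟩ := CohNerve.exists_retraction {x | ¬ f.Omits x} ⟨a, fun h => h.1 rfl⟩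
  obtain ⟨j, hj, h⟩ := h
  exact ⟨ρ, ⟨j, hj, fun x e => h1 x (e ▸ h)⟩, h1, h2⟩

end Cube

/-- A compatible family of functors `𝚫_𝔑ᵏ ⟶ E` indexed by the simplices of the `i`-th horn. -/
structure HornFamily (i : Fin (n + 1)) (E : SCat) where
  functor {k : ℕ} (σ : Fin (k + 1) →o Fin (n + 1)) : InHorn i σ → (thick (Fin (k + 1)) ⟶ E)
  functor_comp {k l : ℕ} (σ : Fin (l + 1) →o Fin (n + 1)) (hσ : InHorn i σ)
    (τ : Fin (k + 1) →o Fin (l + 1)) :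
    functor (σ.comp τ) (hσ.comp τ) = thickMap τ ≫ functor σ hσ

/-! ### Extension of a family of functors on the horn to the generated subcategory. -/

namespace HornFamily

variable {E : SCat} (F : HornFamily i E) (hi : 0 < i ∧ i < Fin.last n)

/-- The action on objects of the functor given by a family. -/
noncomputable def obj (x : Fin (n + 1)) : E.Ob :=
  SCat.fobj (F.functor (k := 0) (OrderHom.const _ x) (inHorn_const hi x)) (0 : Fin 1)

/-- The action on simplices of maps of the members of the family. -/
noncomputable def act {k : ℕ} (σ : Fin (k + 1) →o Fin (n + 1)) (hσ : InHorn i σ)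
    {a b : Fin (k + 1)} (f : Cube a b m) :
    (E.Map (SCat.fobj (F.functor σ hσ) a) (SCat.fobj (F.functor σ hσ) b)).obj m :=
  (SCat.fmap (F.functor σ hσ) a b).app m f

/-- Compatibility of the family with the inclusion of the vertex `x`. -/
lemma fobj_functor {k : ℕ} (σ : Fin (k + 1) →o Fin (n + 1)) (hσ : InHorn i σ) (x : Fin (k + 1)) :
    SCat.fobj (F.functor σ hσ) x = F.obj hi (σ x) :=
  (SCat.fobj_eq_of_eq (F.functor_comp σ hσ (OrderHom.const (Fin 1) x)) (0 : Fin 1)).symm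

lemma act_congr {k : ℕ} {σ σ' : Fin (k + 1) →o Fin (n + 1)} (h : σ = σ') (hσ : InHorn i σ)
    {a b a' b' : Fin (k + 1)} {f : Cube a b m} {f' : Cube a' b' m} (ha : a = a') (hb : b = b')
    (hf : HEq f f') : HEq (F.act σ hσ f) (F.act σ' (h ▸ hσ) f') := by
  subst h ha hb
  rw [eq_of_heq hf]

lemma act_comp_heq {k l : ℕ} (σ : Fin (l + 1) →o Fin (n + 1)) (hσ : InHorn i σ)
    (τ : Fin (k + 1) →o Fin (l + 1)) {a b : Fin (k + 1)} (f : Cube a b m) :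
    HEq (F.act (σ.comp τ) (hσ.comp τ) f) (F.act σ hσ (f.push τ)) :=
  SCat.heq_of_eq (F.functor_comp σ hσ τ) f

/-- `v` is the value at `f` of the functor given by a family. -/
def IsValue {a b : Fin (n + 1)} (f : Cube a b m) (v : (E.Map (F.obj hi a) (F.obj hi b)).obj m) :
    Prop :=
  ∀ (k : ℕ) (σ : Fin (k + 1) →o Fin (n + 1)) (hσ : InHorn i σ) (a' b' : Fin (k + 1))
    (g : Cube a' b' m), σ a' = a → σ b' = b → HEq (g.push σ) f → HEq (F.act σ hσ g) v

/-- The candidate is the action on `f` of a retraction `ρ` onto the vertices not omitted by `f`. If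
`f` is also the image of `g` under `σ`, let `ρ'` be a retraction onto the vertices not omitted by
`g`. Then `ρ'` fixes `g`, `ρ` fixes the images under `σ` of those vertices, and compatibility of the
family compares the two actions. -/
lemma exists_isValue {a b : Fin (n + 1)} (f : Cube a b m) (hf : f.Small i) :
    ∃ v, F.IsValue hi f v := by
  obtain ⟨ρ, hρ, h1, h2⟩ := hf.exists_retraction
  have ha : ρ a = a := h2 _ fun h => h.1 rfl
  have hb : ρ b = b := h2 _ fun h => h.2.1 rfl
  have ha' := (F.fobj_functor hi ρ hρ a).trans (congrArg _ ha)
  have hb' := (F.fobj_functor hi ρ hρ b).trans (congrArg _ hb)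
  obtain ⟨v, hv⟩ : ∃ v : (E.Map (F.obj hi a) (F.obj hi b)).obj m, HEq v (F.act ρ hρ f) := by
    rw [← ha', ← hb']
    exact ⟨_, HEq.rfl⟩
  refine ⟨v, ?_⟩
  rintro k σ hσ a' b' g rfl rfl hg
  obtain rfl := eq_of_heq hg
  obtain ⟨ρ', h1', h2'⟩ := exists_retraction {x | ¬ g.Omits x} ⟨a', fun h => h.1 rfl⟩
  have ea : ρ' a' = a' := h2' _ fun h => h.1 rfl
  have eb : ρ' b' = b' := h2' _ fun h => h.2.1 rfl
  have hg' : HEq (g.push ρ') g := Cube.push_heq_self ρ' _ h2' g fun x hx => not_not.1 hx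
  -- By `Omits.of_push`, `σ` sends the values of `ρ'` to vertices that `f` does not omit, and these
  -- are fixed by `ρ`.
  have e : (ρ.comp σ).comp ρ' = σ.comp ρ' := by
    ext x
    exact congrArg Fin.val (h2 _ fun h => h1' x h.of_push)
  -- Along the chain, the action on `g` passes from `σ` to `σρ' = ρσρ'`, applied to `g`, then to
  -- `ρσ`, and finally to `ρ` applied to `f`.
  refine (F.act_congr rfl hσ ea.symm eb.symm hg'.symm).trans ?_
  refine (F.act_comp_heq σ hσ ρ' g).symm.trans ?_
  refine (F.act_congr e.symm _ rfl rfl HEq.rfl).trans ?_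
  refine (F.act_comp_heq _ (hρ.comp σ) _ _).trans ?_
  refine (F.act_congr rfl _ ea eb hg').trans ?_
  exact (F.act_comp_heq _ hρ _ _).trans hv.symm

/-- The value at a small simplex of the functor given by a family. -/
noncomputable def value {a b : Fin (n + 1)} (f : Cube a b m) (hf : f.Small i) :
    (E.Map (F.obj hi a) (F.obj hi b)).obj m :=
  (F.exists_isValue hi f hf).choose

lemma act_heq_value {k : ℕ} (σ : Fin (k + 1) →o Fin (n + 1)) (hσ : InHorn i σ)
    {a b : Fin (k + 1)} (f : Cube a b m) :
    HEq (F.act σ hσ f) (F.value hi (f.push σ) (Cube.small_push hσ f)) :=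
  (F.exists_isValue hi _ (Cube.small_push hσ f)).choose_spec k σ hσ a b f rfl rfl HEq.rfl

lemma act_heq_value_of_retraction (ρ : Fin (n + 1) →o Fin (n + 1)) (hρ : InHorn i ρ)
    {T : Set (Fin (n + 1))} (hT : ∀ x ∈ T, ρ x = x) {a b : Fin (n + 1)} (f : Cube a b m)
    (hf : f.Small i) (hfT : ∀ x ∉ T, f.Omits x) : HEq (F.act ρ hρ f) (F.value hi f hf) :=
  (F.exists_isValue hi f hf).choose_spec _ ρ hρ a b f
    (hT _ (by by_contra h; exact (hfT _ h).1 rfl)) (hT _ (by by_contra h; exact (hfT _ h).2.1 rfl))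
    (Cube.push_heq_self ρ T hT f hfT)

lemma fobj_functor_of_eq {k : ℕ} (σ : Fin (k + 1) →o Fin (n + 1)) (hσ : InHorn i σ)
    {x : Fin (k + 1)} {y : Fin (n + 1)} (h : σ x = y) :
    SCat.fobj (F.functor σ hσ) x = F.obj hi y :=
  (F.fobj_functor hi σ hσ x).trans (congrArg _ h)

/-- One retraction serves for all three values: the factors omit every vertex that the composite
omits, and the middle object is never omitted. The claim is then functoriality of the single functor
at this retraction. -/
lemma value_comp {a b c : Fin (n + 1)} (f : Cube a b m) (g : Cube b c m)
    (h : (f.comp g).Small i) :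
    F.value hi (f.comp g) h =
      SCat.comp (F.value hi f h.of_comp_left) (F.value hi g h.of_comp_right) := by
  obtain ⟨ρ, hρ, h1, h2⟩ := h.exists_retraction
  have ha := F.fobj_functor_of_eq hi ρ hρ (h2 a fun h => h.1 rfl)
  have hb := F.fobj_functor_of_eq hi ρ hρ (h2 b fun h => h.ne_of_comp rfl)
  have hc := F.fobj_functor_of_eq hi ρ hρ (h2 c fun h => h.2.1 rfl)
  apply eq_of_heq
  refine (F.act_heq_value_of_retraction hi ρ hρ h2 _ h fun x hx => not_not.1 hx).symm.trans ?_
  refine (heq_of_eq (SCat.fmap_comp (C := thick (Fin (n + 1))) (F.functor ρ hρ) f g)).trans ?_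
  exact SCat.comp_heq ha hb hc
    (F.act_heq_value_of_retraction hi ρ hρ h2 _ _ fun x hx => (not_not.1 hx).of_comp_left)
    (F.act_heq_value_of_retraction hi ρ hρ h2 _ _ fun x hx => (not_not.1 hx).of_comp_right)

lemma value_res {a b : Fin (n + 1)} (f : Cube a b m) (hf : f.Small i) (θ : m ⟶ m') :
    F.value hi (f.res θ) (hf.res θ) =
      (E.Map (F.obj hi a) (F.obj hi b)).map θ (F.value hi f hf) := by
  obtain ⟨ρ, hρ, h1, h2⟩ := hf.exists_retraction
  have ha := F.fobj_functor_of_eq hi ρ hρ (h2 a fun h => h.1 rfl)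
  have hb := F.fobj_functor_of_eq hi ρ hρ (h2 b fun h => h.2.1 rfl)
  apply eq_of_heq
  refine (F.act_heq_value_of_retraction hi ρ hρ h2 _ (hf.res θ)
    fun x hx => (not_not.1 hx).res θ).symm.trans ?_
  refine (heq_of_eq (SCat.fmap_nat (C := thick (Fin (n + 1))) (F.functor ρ hρ) θ f)).trans ?_
  exact SCat.map_heq ha hb
    (F.act_heq_value_of_retraction hi ρ hρ h2 _ hf fun x hx => not_not.1 hx) θ

lemma value_one {a : Fin (n + 1)} (f : Cube a a m) (hf : f.Small i) :
    F.value hi f hf = SCat.one (F.obj hi a) m := by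
  obtain ⟨ρ, hρ, h1, h2⟩ := hf.exists_retraction
  have ha := F.fobj_functor_of_eq hi ρ hρ (h2 a fun h => h.1 rfl)
  apply eq_of_heq
  obtain rfl : f = SCat.one (C := thick (Fin (n + 1))) a m := Subsingleton.elim _ _
  refine (F.act_heq_value_of_retraction hi ρ hρ h2 _ hf fun x hx => not_not.1 hx).symm.trans ?_
  exact (heq_of_eq (SCat.fmap_one (C := thick (Fin (n + 1))) (F.functor ρ hρ) a m)).trans
    (SCat.one_heq ha)

/-- The composite of the values at the two parts of a simplex that divides at `c`. -/
noncomputable def cutValue {a b c : Fin (n + 1)} (f : Cube a b m) (h : f.Cuts c) :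
    (E.Map (F.obj hi a) (F.obj hi b)).obj m :=
  SCat.comp (F.value hi _ (h.small_left hi)) (F.value hi _ (h.small_right hi))

lemma cutValue_eq_value {a b c : Fin (n + 1)} (f : Cube a b m) (h : f.Cuts c) (hf : f.Small i) :
    F.cutValue hi f h = F.value hi f hf := by
  have e := h.left_comp_right
  have := F.value_comp hi (f.left c h.1.1.le h.1.2.le) (f.right c h.1.1.le h.1.2.le)
    (by rwa [e])
  rw [cutValue, ← this]
  congr 1

/-- Cutting at both places divides `f` into three parts, and both sides are the composite of their
values, bracketed differently. -/
lemma cutValue_eq_of_lt {a b c d : Fin (n + 1)} (f : Cube a b m) (hc : f.Cuts c) (hd : f.Cuts d)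
    (hcd : c < d) : F.cutValue hi f hc = F.cutValue hi f hd := by
  have h1 : (f.left d hd.1.1.le hd.1.2.le).Cuts c := ⟨⟨hc.1.1, hcd⟩, hc.2⟩
  have h2 : (f.right c hc.1.1.le hc.1.2.le).Cuts d := ⟨⟨hcd, hd.1.2⟩, hd.2⟩
  rw [cutValue, cutValue, ← F.cutValue_eq_value hi _ h1, ← F.cutValue_eq_value hi _ h2, cutValue,
    cutValue, SCat.assoc]
  rfl

lemma cutValue_eq {a b c d : Fin (n + 1)} (f : Cube a b m) (hc : f.Cuts c) (hd : f.Cuts d) :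
    F.cutValue hi f hc = F.cutValue hi f hd := by
  rcases lt_trichotomy c d with h | rfl | h
  · exact F.cutValue_eq_of_lt hi f hc hd h
  · rfl
  · exact (F.cutValue_eq_of_lt hi f hd hc h).symm

open Classical in
/-- The action on simplices of maps of the functor given by a family. -/
noncomputable def boxValue {a b : Fin (n + 1)} (f : Cube a b m) (hf : f.InBox i) :
    (E.Map (F.obj hi a) (F.obj hi b)).obj m :=
  if h : f.Small i then F.value hi f h else F.cutValue hi f (hf.resolve_left h).choose_spec

lemma boxValue_of_small {a b : Fin (n + 1)} (f : Cube a b m) (hf : f.Small i) :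
    F.boxValue hi f (Or.inl hf) = F.value hi f hf :=
  dif_pos hf

lemma boxValue_of_cuts {a b c : Fin (n + 1)} (f : Cube a b m) (h : f.Cuts c) :
    F.boxValue hi f (Or.inr ⟨c, h⟩) = F.cutValue hi f h := by
  by_cases hf : f.Small i
  · exact (dif_pos hf).trans (F.cutValue_eq_value hi f h hf).symm
  · exact (dif_neg hf).trans (F.cutValue_eq hi _ _ _)

lemma boxValue_one {a : Fin (n + 1)} (f : Cube a a m) (hf : f.InBox i) :
    F.boxValue hi f hf = SCat.one (F.obj hi a) m := by
  have h : f.Small i := hf.elim id fun ⟨c, hc, _⟩ => absurd (hc.1.trans hc.2) (lt_irrefl _)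
  exact (F.boxValue_of_small hi f h).trans (F.value_one hi f h)

lemma boxValue_comp {a b c : Fin (n + 1)} (f : Cube a b m) (g : Cube b c m) (hf : f.InBox i)
    (hg : g.InBox i) :
    F.boxValue hi (f.comp g) (hf.comp hg) =
      SCat.comp (F.boxValue hi f hf) (F.boxValue hi g hg) := by
  rcases f.le.eq_or_lt with rfl | hab
  · rw [F.boxValue_one hi f, SCat.one_comp]
    congr 1
    exact Cube.comp_of_eq_left _ _
  rcases g.le.eq_or_lt with rfl | hbc
  · rw [F.boxValue_one hi g, SCat.comp_one]
    congr 1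
    exact Cube.comp_of_eq_right _ _
  have h := Cube.cuts_comp f g hab hbc
  have h1 : f.Small i := Cube.small_of_ne_last hi f (hbc.trans_le (Fin.le_last _)).ne
  have h2 : g.Small i := Cube.small_of_ne_zero hi g ((Fin.zero_le _).trans_lt hab).ne'
  refine (F.boxValue_of_cuts hi _ h).trans ?_
  rw [F.boxValue_of_small hi f h1, F.boxValue_of_small hi g h2, cutValue]
  congr 2
  · exact Cube.left_comp f g
  · exact Cube.right_comp f g

lemma boxValue_res {a b : Fin (n + 1)} (f : Cube a b m) (hf : f.InBox i) (θ : m ⟶ m') :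
    F.boxValue hi (f.res θ) (hf.res θ) =
      (E.Map (F.obj hi a) (F.obj hi b)).map θ (F.boxValue hi f hf) := by
  rcases hf with hf | ⟨c, hf⟩
  · rw [F.boxValue_of_small hi f hf, ← F.value_res]
    exact F.boxValue_of_small hi _ (hf.res θ)
  · rw [F.boxValue_of_cuts hi f hf, cutValue, SCat.map_comp, ← F.value_res, ← F.value_res]
    exact F.boxValue_of_cuts hi _ (hf.res θ)

end HornFamily

end

/-! ### The identification of `𝚫_𝔑(Λⁿᵢ)` with the generated subcategory. -/

section

variable {n : ℕ} {i : Fin (n + 1)} (hi : 0 < i ∧ i < Fin.last n) {m m' : SimplexCategoryᵒᵖ}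

/-- The simplicial sets of maps of the simplicial subcategory of `𝚫_𝔑ⁿ` generated by the horn. -/
def boxHom (i a b : Fin (n + 1)) : SSet.{0} where
  obj m := {f : Cube a b m // f.InBox i}
  map θ := ↾fun f => ⟨f.1.res θ, f.2.res θ⟩

/-- The simplicial subcategory of `𝚫_𝔑ⁿ` generated by the `i`-th horn, in levelwise form. -/
noncomputable def boxLevelwise (hi : 0 < i ∧ i < Fin.last n) : Levelwise (Fin (n + 1)) where
  Hom a b := boxHom i a b
  one a m := ⟨(thickLevelwise (Fin (n + 1))).one a m, Cube.inBox_one hi _⟩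
  comp f g := ⟨f.1.comp g.1, f.2.comp g.2⟩
  map_one a _ _ θ := Subtype.ext ((thickLevelwise (Fin (n + 1))).map_one a θ)
  map_comp θ f g := Subtype.ext ((thickLevelwise (Fin (n + 1))).map_comp θ f.1 g.1)
  one_comp f := Subtype.ext ((thickLevelwise (Fin (n + 1))).one_comp f.1)
  comp_one f := Subtype.ext ((thickLevelwise (Fin (n + 1))).comp_one f.1)
  assoc f g h := Subtype.ext ((thickLevelwise (Fin (n + 1))).assoc f.1 g.1 h.1)

/-- The simplicial subcategory of `𝚫_𝔑ⁿ` generated by the `i`-th horn. -/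
noncomputable def boxCat (hi : 0 < i ∧ i < Fin.last n) : SCat :=
  letI := (boxLevelwise hi).toEnriched
  { Ob := Fin (n + 1) }

/-- The inclusion of the simplicial subcategory generated by the horn. -/
noncomputable def boxι : boxCat hi ⟶ thick (Fin (n + 1)) :=
  SCat.mkHom (C := boxCat hi) (D := thick (Fin (n + 1))) (fun a => a)
    (fun {a b m} (f : {f : Cube (J := Fin (n + 1)) a b m // f.InBox i}) => f.1)
    (fun _ _ => rfl) (fun _ _ => rfl) (fun _ _ => rfl)

lemma boxι_comp_injective {C : SCat} {F G : C ⟶ boxCat hi} (h : F ≫ boxι hi = G ≫ boxι hi) :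
    F = G := by
  obtain ⟨Fo, Fm, h1, h2⟩ := F
  obtain ⟨Go, Gm, h3, h4⟩ := G
  have ho : Fo = Go := funext fun x => SCat.fobj_eq_of_eq h x
  subst ho
  refine SCat.hom_ext _ _ (fun _ => rfl) fun x y m f => heq_of_eq ?_
  exact Subtype.ext (eq_of_heq (SCat.heq_of_eq h f))

/-- The functor `𝚫_𝔑ᵏ ⟶ 𝚫_𝔑ⁿ` given by a simplex of the horn, with restricted codomain. -/
noncomputable def toBox {k : ℕ} (σ : Fin (k + 1) →o Fin (n + 1)) (hσ : InHorn i σ) :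
    thick (Fin (k + 1)) ⟶ boxCat hi :=
  SCat.mkHom (C := thick (Fin (k + 1))) (D := boxCat hi) (fun a => σ a)
    (fun {a b m} (f : Cube (J := Fin (k + 1)) a b m) =>
      (⟨f.push σ, Or.inl (Cube.small_push hσ f)⟩ :
        {f : Cube (J := Fin (n + 1)) (σ a) (σ b) m // f.InBox i}))
    (fun {_ _ _ _} θ f => Subtype.ext (Cube.push_res σ θ f))
    (fun a m => Subtype.ext (SCat.fmap_one (thickMap σ) a m))
    (fun {_ _ _ _} f g => Subtype.ext (Cube.push_comp σ f g))

lemma toBox_comp {k l : ℕ} (τ : Fin (k + 1) →o Fin (l + 1)) (σ : Fin (l + 1) →o Fin (n + 1))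
    (hσ : InHorn i σ) : toBox hi (σ.comp τ) (hσ.comp τ) = thickMap τ ≫ toBox hi σ hσ :=
  boxι_comp_injective hi (thickMap_comp τ σ)

lemma inHorn_asOrderHom {k : SimplexCategory} (x : (SSet.horn.{0} n i).toSSet.obj (op k)) :
    InHorn i (SSet.stdSimplex.asOrderHom x.1) := by
  obtain ⟨x, hx⟩ := x
  rw [SSet.mem_horn_iff, Ne, Set.eq_univ_iff_forall, not_forall] at hx
  obtain ⟨j, hj⟩ := hx
  rw [Set.mem_union, not_or] at hj
  exact ⟨j, hj.2, fun y e => hj.1 ⟨y, e⟩⟩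

/-- The canonical functor from `𝚫_𝔑(Λⁿᵢ)` to the simplicial subcategory of `𝚫_𝔑ⁿ`. -/
noncomputable def hornToBox : thickening.obj (SSet.horn.{0} n i).toSSet ⟶ boxCat hi :=
  thickeningDesc (X := (SSet.horn.{0} n i).toSSet)
    (fun _ x => toBox hi (SSet.stdSimplex.asOrderHom x.1) (inHorn_asOrderHom x))
    (fun θ x => toBox_comp hi θ.toOrderHom _ (inHorn_asOrderHom x))

lemma simplexFunctor_hornToBox {k : SimplexCategory}
    (x : (SSet.horn.{0} n i).toSSet.obj (op k)) :
    simplexFunctor x ≫ hornToBox hi =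
      toBox hi (SSet.stdSimplex.asOrderHom x.1) (inHorn_asOrderHom x) :=
  simplexFunctor_thickeningDesc _ (fun θ x => toBox_comp hi θ.toOrderHom _ (inHorn_asOrderHom x)) x

lemma hornToBox_boxι : hornToBox hi ≫ boxι hi = hornMap n i := by
  refine thickening_hom_ext fun _ x => ?_
  rw [← Category.assoc, simplexFunctor_hornToBox, simplexFunctor_hornMap]
  rfl

/-- The functor from the simplicial subcategory generated by the horn given by a family. -/
noncomputable def HornFamily.desc {E : SCat} (F : HornFamily i E) : boxCat hi ⟶ E :=
  SCat.mkHom (C := boxCat hi) (D := E) (F.obj hi)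
    (fun {a b m} (f : {f : Cube (J := Fin (n + 1)) a b m // f.InBox i}) => F.boxValue hi f.1 f.2)
    (fun {_ _ _ _} θ f => F.boxValue_res hi f.1 f.2 θ)
    (fun _ _ => F.boxValue_one hi _ _)
    (fun {_ _ _ _} f g => F.boxValue_comp hi f.1 g.1 f.2 g.2)

lemma HornFamily.toBox_desc {E : SCat} (F : HornFamily i E) {k : ℕ}
    (σ : Fin (k + 1) →o Fin (n + 1)) (hσ : InHorn i σ) :
    toBox hi σ hσ ≫ F.desc hi = F.functor σ hσ := by
  refine SCat.hom_ext _ _ (fun x => (F.fobj_functor hi σ hσ x).symm) fun x y m f => ?_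
  exact (heq_of_eq (F.boxValue_of_small hi _ _)).trans (F.act_heq_value hi σ hσ f).symm

lemma Cube.inBox_mk_heq {a b a' b' : Fin (n + 1)} (ha : a = a') (hb : b = b') {f : Cube a b m}
    {g : Cube a' b' m} (h : HEq f g) (hf : f.InBox i) (hg : g.InBox i) :
    HEq (⟨f, hf⟩ : {f : Cube a b m // f.InBox i}) (⟨g, hg⟩ : {f : Cube a' b' m // f.InBox i}) := by
  subst ha hb
  obtain rfl := eq_of_heq h
  rfl

/-- A functor from the simplicial subcategory generated by the horn is determined by its restrictions
to the simplices of the horn. -/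
lemma boxCat_hom_ext {E : SCat} {F G : boxCat hi ⟶ E}
    (h : ∀ (σ : Fin (n + 1) →o Fin (n + 1)) (hσ : InHorn i σ),
      toBox hi σ hσ ≫ F = toBox hi σ hσ ≫ G) : F = G := by
  have hobj : ∀ x : Fin (n + 1), SCat.fobj F x = SCat.fobj G x := fun x =>
    SCat.fobj_eq_of_eq (h (OrderHom.const _ x) (inHorn_const hi x)) (0 : Fin (n + 1))
  have hsmall : ∀ (a b : Fin (n + 1)) (m : SimplexCategoryᵒᵖ) (f : Cube a b m) (hf : f.Small i),
      HEq ((SCat.fmap F a b).app m (⟨f, Or.inl hf⟩ : {f : Cube a b m // f.InBox i}))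
        ((SCat.fmap G a b).app m (⟨f, Or.inl hf⟩ : {f : Cube a b m // f.InBox i})) := by
    intro a b m f hf
    -- The retraction is itself a simplex of the horn and fixes `f`, so `f` is the image of `f`
    -- under `toBox` of this simplex.
    obtain ⟨ρ, hρ, -, h2⟩ := hf.exists_retraction
    have ha : ρ a = a := h2 a fun h => h.1 rfl
    have hb : ρ b = b := h2 b fun h => h.2.1 rfl
    have hρf : HEq (f.push ρ) f := Cube.push_heq_self ρ _ h2 f fun x hx => not_not.1 hx
    have key := Cube.inBox_mk_heq ha hb hρf (Or.inl (Cube.small_push hρ f)) (Or.inl hf)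
    exact (SCat.fmap_heq F ha.symm hb.symm key.symm).trans
      ((SCat.heq_of_eq (h ρ hρ) f).trans (SCat.fmap_heq G ha hb key))
  refine SCat.hom_ext _ _ hobj ?_
  rintro (a : Fin (n + 1)) (b : Fin (n + 1)) m ⟨f, hf | ⟨c, hf⟩⟩
  · exact hsmall a b m f hf
  · have e : (⟨f, Or.inr ⟨c, hf⟩⟩ : {f : Cube (J := Fin (n + 1)) a b m // f.InBox i}) =
        SCat.comp (C := boxCat hi) (x := a) (y := c) (z := b)
          (⟨_, Or.inl (hf.small_left hi)⟩ : {f : Cube a c m // f.InBox i})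
          (⟨_, Or.inl (hf.small_right hi)⟩ : {f : Cube c b m // f.InBox i}) :=
      Subtype.ext hf.left_comp_right.symm
    rw [e]
    refine (heq_of_eq (SCat.fmap_comp _ _ _)).trans
      (HEq.trans ?_ (heq_of_eq (SCat.fmap_comp _ _ _).symm))
    exact SCat.comp_heq (hobj _) (hobj _) (hobj _) (hsmall _ _ _ _ (hf.small_left hi))
      (hsmall _ _ _ _ (hf.small_right hi))

/-- The simplex of the horn given by a monotone map. -/
def hornSimplex {k : ℕ} (σ : Fin (k + 1) →o Fin (n + 1)) (hσ : InHorn i σ) :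
    (SSet.horn.{0} n i).toSSet.obj (op (SimplexCategory.mk k)) :=
  ⟨SSet.stdSimplex.objMk σ, by
    rw [SSet.mem_horn_iff, Ne, Set.eq_univ_iff_forall, not_forall]
    obtain ⟨j, hj, h⟩ := hσ
    refine ⟨j, ?_⟩
    rw [Set.mem_union, not_or]
    exact ⟨fun ⟨x, hx⟩ => h x hx, hj⟩⟩

/-- The tautological family with values in `𝚫_𝔑(Λⁿᵢ)`. -/
noncomputable def hornFamily (i : Fin (n + 1)) :
    HornFamily i (thickening.obj (SSet.horn.{0} n i).toSSet) where
  functor σ hσ := simplexFunctor (hornSimplex σ hσ)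
  functor_comp σ hσ τ :=
    (thickMap_simplexFunctor (SimplexCategory.Hom.mk τ) (hornSimplex σ hσ)).symm

/-- The identification of `𝚫_𝔑(Λⁿᵢ)` with a simplicial subcategory of `𝚫_𝔑ⁿ`. -/
noncomputable def hornIso : thickening.obj (SSet.horn.{0} n i).toSSet ≅ boxCat hi where
  hom := hornToBox hi
  inv := (hornFamily i).desc hi
  hom_inv_id := thickening_hom_ext fun k x => by
    rw [← Category.assoc, simplexFunctor_hornToBox]
    refine ((hornFamily i).toBox_desc hi _ _).trans ?_
    rw [Category.comp_id]
    rfl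
  inv_hom_id := boxCat_hom_ext hi fun σ hσ => by
    rw [← Category.assoc, (hornFamily i).toBox_desc hi σ hσ, Category.comp_id]
    exact simplexFunctor_hornToBox hi (hornSimplex σ hσ)

end

/-! ### The inclusion of the generated subcategory is a cofibration. -/

section

section Arrow

variable {C D : SCat} {K L : SSet.{0}}

/-- The action on maps of the functor `K₀₁ ⟶ C` given by `u : K ⟶ C(x, y)`. -/
def arrowFunctorMap {x y : C.Ob} (u : K ⟶ C.Map x y) {m : SimplexCategoryᵒᵖ} :
    ∀ {a b : Bool}, (arrowHom K a b).obj m →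
      (C.Map (bif a then y else x) (bif b then y else x)).obj m
  | false, false, _ => SCat.one x m
  | false, true, f => u.app m f
  | true, false, f => PEmpty.elim f
  | true, true, _ => SCat.one y m

/-- The functor `K₀₁ ⟶ C` given by `u : K ⟶ C(x, y)`. -/
noncomputable def arrowFunctor {x y : C.Ob} (u : K ⟶ C.Map x y) : arrowCat K ⟶ C :=
  SCat.mkHom (C := arrowCat K) (fun a : Bool => bif a then y else x)
    (fun {a b m} f => arrowFunctorMap u (a := a) (b := b) f)
    (fun {a b : Bool} {m m'} θ f => by
      cases a <;> cases b
      · exact (SCat.map_one θ).symm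
      · exact ConcreteCategory.congr_hom (u.naturality θ) f
      · exact PEmpty.elim f
      · exact (SCat.map_one θ).symm)
    (fun (a : Bool) m => by cases a <;> rfl)
    (fun {a b c : Bool} {m} f g => by
      cases a <;> cases b <;> cases c <;>
        first
        | exact PEmpty.elim f
        | exact PEmpty.elim g
        | exact (SCat.one_comp _).symm
        | exact (SCat.comp_one _).symm)

lemma exists_hom_heq {S : SSet.{0}} {x y x' y' : C.Ob} (hx : x = x') (hy : y = y')
    (u : S ⟶ C.Map x y) :
    ∃ v : S ⟶ C.Map x' y', ∀ (m : SimplexCategoryᵒᵖ) (f : S.obj m), HEq (v.app m f) (u.app m f) := by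
  subst hx hy
  exact ⟨u, fun _ _ => HEq.rfl⟩

/-- A simplicial functor with the right lifting property against the generating cofibrations
induces maps with the right lifting property against monomorphisms. -/
lemma exists_lift_of_rlp {p : C ⟶ D} (hp : generatingCofibrations.rlp p) (j : K ⟶ L) [Mono j]
    {x y : C.Ob} (u : K ⟶ C.Map x y) (v : L ⟶ D.Map (SCat.fobj p x) (SCat.fobj p y))
    (w : u ≫ SCat.fmap p x y = j ≫ v) :
    ∃ l : L ⟶ C.Map x y, j ≫ l = u ∧ l ≫ SCat.fmap p x y = v := by
  have sq : CommSq (arrowFunctor u) (arrowMap j) p (arrowFunctor v) := ⟨by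
    refine SCat.hom_ext _ _ (fun (a : Bool) => by cases a <;> rfl) ?_
    rintro (a : Bool) (b : Bool) m f
    cases a <;> cases b
    · exact heq_of_eq (SCat.fmap_one p x m)
    · exact heq_of_eq (ConcreteCategory.congr_hom (congr_app w m) f)
    · exact PEmpty.elim f
    · exact heq_of_eq (SCat.fmap_one p y m)⟩
  have := hp _ (generatingCofibrations.arrow j)
  have h1 : arrowMap j ≫ sq.lift = arrowFunctor u := sq.fac_left
  have h2 : sq.lift ≫ p = arrowFunctor v := sq.fac_right
  generalize sq.lift = q at h1 h2
  have hx : SCat.fobj q (false : Bool) = x := SCat.fobj_eq_of_eq h1 (false : Bool)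
  have hy : SCat.fobj q (true : Bool) = y := SCat.fobj_eq_of_eq h1 (true : Bool)
  -- The lift `q` takes the objects `0`, `1` to `x`, `y`, so its effect on the maps from `0` to `1`
  -- is a map into `C(x, y)`.
  obtain ⟨l, hl⟩ := exists_hom_heq hx hy (SCat.fmap q (false : Bool) (true : Bool))
  refine ⟨l, ?_, ?_⟩
  · ext m f
    exact eq_of_heq ((hl m _).trans (SCat.heq_of_eq h1 (x := (false : Bool)) (y := (true : Bool)) f))
  · ext m f
    exact eq_of_heq ((SCat.fmap_heq p hx.symm hy.symm (hl m f)).trans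
      (SCat.heq_of_eq h2 (x := (false : Bool)) (y := (true : Bool)) f))

end Arrow

variable {n : ℕ} {i : Fin (n + 1)} (hi : 0 < i ∧ i < Fin.last n) {m m' : SimplexCategoryᵒᵖ}

/-- The inclusion of the maps of the simplicial subcategory generated by the horn. -/
def boxHomι (i a b : Fin (n + 1)) : boxHom i a b ⟶ cubeHom a b where
  app _ := ↾fun f => f.1

instance (a b : Fin (n + 1)) : Mono (boxHomι i a b) := by
  have (m : SimplexCategoryᵒᵖ) : Mono ((boxHomι i a b).app m) := by
    rw [mono_iff_injective]
    exact Subtype.val_injective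
  exact NatTrans.mono_of_mono_app _

/-- The lifts on the simplicial sets of maps are chosen independently of each other. No further
compatibility is needed: the lift is prescribed on the box, which contains the identities, the
composites of nontrivial maps and the factors of such composites. -/
lemma cofibrations_boxι : cofibrations (boxι hi) := by
  intro X Y p hp
  refine ⟨fun {f g} sq => ?_⟩
  have hw := sq.w
  have hobj (a : Fin (n + 1)) : SCat.fobj p (SCat.fobj f a) = SCat.fobj g a :=
    SCat.fobj_eq_of_eq hw a
  have lifts (a b : Fin (n + 1)) : ∃ l : cubeHom a b ⟶ X.Map (SCat.fobj f a) (SCat.fobj f b),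
      boxHomι i a b ≫ l = SCat.fmap f a b ∧ ∀ (m : SimplexCategoryᵒᵖ) (c : Cube a b m),
        HEq ((SCat.fmap p _ _).app m (l.app m c)) ((SCat.fmap g a b).app m c) := by
    obtain ⟨v, hv⟩ := exists_hom_heq (hobj a).symm (hobj b).symm
      (SCat.fmap g a b)
    obtain ⟨l, h1, h2⟩ := exists_lift_of_rlp hp (boxHomι i a b) (SCat.fmap f a b) v (by
      ext m c
      exact eq_of_heq ((SCat.heq_of_eq hw c).trans (hv m c.1).symm))
    refine ⟨l, h1, fun m c => ?_⟩
    exact (heq_of_eq (ConcreteCategory.congr_hom (congr_app h2 m) c)).trans (hv m c)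
  choose l h1 h2 using lifts
  have hbox {a b : Fin (n + 1)} {m : SimplexCategoryᵒᵖ} (c : Cube a b m) (hc : c.InBox i) :
      (l a b).app m c = (SCat.fmap f a b).app m (⟨c, hc⟩ : {f : Cube a b m // f.InBox i}) :=
    ConcreteCategory.congr_hom (congr_app (h1 a b) m)
      (⟨c, hc⟩ : {f : Cube a b m // f.InBox i})
  have hone (a : Fin (n + 1)) {m : SimplexCategoryᵒᵖ} (c : Cube a a m) :
      (l a a).app m c = SCat.one (SCat.fobj f a) m := by
    refine (hbox c (Cube.inBox_one hi c)).trans (Eq.trans ?_ (SCat.fmap_one f a m))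
    exact congrArg _ (Subtype.ext (Subsingleton.elim (α := Cube (J := Fin (n + 1)) a a m) _ _))
  have hcomp {a b c : Fin (n + 1)} {m : SimplexCategoryᵒᵖ} (u : Cube a b m) (v : Cube b c m) :
      (l a c).app m (u.comp v) = SCat.comp ((l a b).app m u) ((l b c).app m v) := by
    rcases u.le.eq_or_lt with rfl | hab
    · rw [hone, SCat.one_comp, Cube.comp_of_eq_left]
    rcases v.le.eq_or_lt with rfl | hbc
    · rw [hone, SCat.comp_one, Cube.comp_of_eq_right]
    have hu : u.InBox i := Or.inl (Cube.small_of_ne_last hi u (hbc.trans_le (Fin.le_last _)).ne)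
    have hv : v.InBox i := Or.inl (Cube.small_of_ne_zero hi v ((Fin.zero_le _).trans_lt hab).ne')
    rw [hbox u hu, hbox v hv, hbox _ (hu.comp hv)]
    exact SCat.fmap_comp (C := boxCat hi) f (x := a) (y := b) (z := c)
      (⟨u, hu⟩ : {f : Cube a b m // f.InBox i}) (⟨v, hv⟩ : {f : Cube b c m // f.InBox i})
  refine ⟨⟨SCat.mkHom (C := thick (Fin (n + 1))) (D := X)
    (fun a => SCat.fobj f a)
    (fun {a b m} c => (l a b).app m c)
    (fun {a b _ _} θ c => ConcreteCategory.congr_hom ((l a b).naturality θ) c)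
    (fun a _ => hone a _) (fun u v => hcomp u v), ?_, ?_⟩⟩
  · refine SCat.hom_ext _ _ (fun _ => rfl) fun a b m c => heq_of_eq ?_
    exact hbox c.1 c.2
  · exact SCat.hom_ext _ _ hobj fun a b m c => h2 a b m c

end

/-! ### Homotopies, weak homotopy equivalences and connected components. -/

section Homotopies

variable {X Y Z K : SSet.{0}}

/-- A homotopy given by a map out of the product with `Δ¹`. -/
def homotopyMk {f g : X ⟶ Y} (h : X ⊗ SSet.stdSimplex.{0}.obj (.mk 1) ⟶ Y)
    (h₀ : SSet.ι₀ ≫ h = f) (h₁ : SSet.ι₁ ≫ h = g) : SSet.Homotopy f g :=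
  { h := h
    h₀ := h₀
    h₁ := h₁
    rel := by
      ext m x
      exact x.1.2.elim }

lemma HoClass.mk_comp_eq {f g : X ⟶ Y} (H : SSet.Homotopy f g) (u : Y ⟶ K) :
    (Quot.mk _ (f ≫ u) : HoClass X K) = Quot.mk _ (g ≫ u) :=
  Quot.sound ⟨homotopyMk (H.h ≫ u) (by rw [← Category.assoc, H.h₀])
    (by rw [← Category.assoc, H.h₁])⟩

lemma HoClass.precomp_mk (f : X ⟶ Y) (u : Y ⟶ K) :
    HoClass.precomp f K (Quot.mk _ u) = Quot.mk _ (f ≫ u) := rfl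

/-- Simplicial homotopy equivalences are weak homotopy equivalences. -/
lemma isWeakHomotopyEquiv_of_homotopies {f : X ⟶ Y} {g : Y ⟶ X}
    (H : SSet.Homotopy (f ≫ g) (𝟙 X)) (H' : SSet.Homotopy (g ≫ f) (𝟙 Y)) :
    IsWeakHomotopyEquiv f := by
  intro K _
  refine Function.bijective_iff_has_inverse.2 ⟨HoClass.precomp g K, ?_, ?_⟩
  · rintro ⟨u⟩
    rw [HoClass.precomp_mk, HoClass.precomp_mk, ← Category.assoc, HoClass.mk_comp_eq H',
      Category.id_comp]
  · rintro ⟨u⟩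
    rw [HoClass.precomp_mk, HoClass.precomp_mk, ← Category.assoc, HoClass.mk_comp_eq H,
      Category.id_comp]

lemma isWeakHomotopyEquiv_of_isIso (f : X ⟶ Y) [IsIso f] : IsWeakHomotopyEquiv f := by
  intro K _
  refine Function.bijective_iff_has_inverse.2 ⟨HoClass.precomp (inv f) K, ?_, ?_⟩
  · rintro ⟨u⟩
    rw [HoClass.precomp_mk, HoClass.precomp_mk, IsIso.inv_hom_id_assoc]
  · rintro ⟨u⟩
    rw [HoClass.precomp_mk, HoClass.precomp_mk, IsIso.hom_inv_id_assoc]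

lemma IsWeakHomotopyEquiv.comp {f : X ⟶ Y} {g : Y ⟶ Z} (hf : IsWeakHomotopyEquiv f)
    (hg : IsWeakHomotopyEquiv g) : IsWeakHomotopyEquiv (f ≫ g) := by
  intro K _
  have : HoClass.precomp (f ≫ g) K = HoClass.precomp f K ∘ HoClass.precomp g K := by
    funext u
    obtain ⟨u, rfl⟩ := Quot.exists_rep u
    simp only [Function.comp, HoClass.precomp_mk, Category.assoc]
    rfl
  rw [this]
  exact (hf K).comp (hg K)

/-- The nondegenerate edge of `Δ¹`. -/
def edgeOne : (SSet.stdSimplex.{0}.obj (.mk 1)).obj (op (.mk 1)) :=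
  SSet.stdSimplex.objEquiv.symm (𝟙 _)

/-- Homotopic maps agree on connected components. -/
lemma mapπ₀_eq_of_homotopy {f g : X ⟶ Y} (H : SSet.Homotopy f g) : SSet.mapπ₀ f = SSet.mapπ₀ g := by
  funext x
  obtain ⟨x, rfl⟩ := SSet.π₀.mk_surjective x
  -- The edge of `X × Δ¹` that is constant at `x` in `X` and nondegenerate in `Δ¹`; the homotopy
  -- takes it to an edge from `f x` to `g x`. Its source is the face `δ 1`, its target the face `δ
  -- 0`.
  have key (j : Fin 2) : (X ⊗ SSet.stdSimplex.{0}.obj (.mk 1)).map (SimplexCategory.δ j).op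
      (pair (X.map (SimplexCategory.σ (0 : Fin 1)).op x) edgeOne) =
      pair x ((SSet.stdSimplex.{0}.obj (.mk 1)).map (SimplexCategory.δ j).op edgeOne) := by
    refine Prod.ext ?_ rfl
    refine (ConcreteCategory.congr_hom (X.map_comp _ _) x).symm.trans ?_
    rw [← op_comp, Subsingleton.elim (SimplexCategory.δ j ≫ SimplexCategory.σ (0 : Fin 1)) (𝟙 _)]
    exact ConcreteCategory.congr_hom (X.map_id _) x
  refine SSet.π₀.sound (SSet.Edge.mk (H.h.app (op (.mk 1))
    (pair (X.map (SimplexCategory.σ (0 : Fin 1)).op x) edgeOne)) ?_ ?_)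
  · refine (ConcreteCategory.congr_hom
      (H.h.naturality (SimplexCategory.δ (1 : Fin 2)).op) _).symm.trans ?_
    refine (congrArg (H.h.app (op (.mk 0))) (key 1)).trans ?_
    refine Eq.trans ?_ (ConcreteCategory.congr_hom (congr_app H.h₀ (op (.mk 0))) x)
    refine congrArg (H.h.app (op (.mk 0))) (Prod.ext rfl ?_)
    ext k
    fin_cases k
    rfl
  · refine (ConcreteCategory.congr_hom
      (H.h.naturality (SimplexCategory.δ (0 : Fin 2)).op) _).symm.trans ?_
    refine (congrArg (H.h.app (op (.mk 0))) (key 0)).trans ?_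
    refine Eq.trans ?_ (ConcreteCategory.congr_hom (congr_app H.h₁ (op (.mk 0))) x)
    refine congrArg (H.h.app (op (.mk 0))) (Prod.ext rfl ?_)
    ext k
    fin_cases k
    rfl

lemma mapπ₀_id_eq : SSet.mapπ₀ (𝟙 X) = id := funext SSet.mapπ₀_id_apply

lemma mapπ₀_comp_eq (f : X ⟶ Y) (g : Y ⟶ Z) :
    SSet.mapπ₀ (f ≫ g) = SSet.mapπ₀ g ∘ SSet.mapπ₀ f :=
  funext (SSet.mapπ₀_comp_apply f g)

lemma mapπ₀_bijective_of_homotopies {f : X ⟶ Y} {g : Y ⟶ X}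
    (H : SSet.Homotopy (f ≫ g) (𝟙 X)) (H' : SSet.Homotopy (g ≫ f) (𝟙 Y)) :
    Function.Bijective (SSet.mapπ₀ f) := by
  have h1 := mapπ₀_eq_of_homotopy H
  have h2 := mapπ₀_eq_of_homotopy H'
  rw [mapπ₀_comp_eq, mapπ₀_id_eq] at h1 h2
  exact Function.bijective_iff_has_inverse.2 ⟨SSet.mapπ₀ g, congrFun h1, congrFun h2⟩

end Homotopies

/-! ### Isomorphisms of simplicial categories and of their categories `π₀`. -/

section PiZero

variable {C D E : SCat}

lemma piZeroMap_id : piZeroMap (𝟙 C) = 𝟭 (PiZero C) :=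
  CategoryTheory.Functor.hext (fun _ => rfl) fun x y f => by
    refine heq_of_eq ?_
    exact SSet.mapπ₀_id_apply f

lemma piZeroMap_comp (F : C ⟶ D) (G : D ⟶ E) :
    piZeroMap (F ≫ G) = piZeroMap F ⋙ piZeroMap G :=
  CategoryTheory.Functor.hext (fun _ => rfl) fun x y f => by
    refine heq_of_eq ?_
    exact SSet.mapπ₀_comp_apply _ _ f

lemma nerveMap_eq_id {C : Type} [SmallCategory C] : nerveMap (𝟭 C) = 𝟙 (nerve C) := rfl

lemma nerveMap_comp {C D E : Type} [SmallCategory C] [SmallCategory D] [SmallCategory E]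
    (F : C ⥤ D) (G : D ⥤ E) : nerveMap (F ⋙ G) = nerveMap F ≫ nerveMap G := rfl

lemma isIso_nerveMap {C D : Type} [SmallCategory C] [SmallCategory D] {F : C ⥤ D} {G : D ⥤ C}
    (h : F ⋙ G = 𝟭 C) (h' : G ⋙ F = 𝟭 D) : IsIso (nerveMap F) :=
  ⟨nerveMap G, by rw [← nerveMap_comp, h, nerveMap_eq_id],
    by rw [← nerveMap_comp, h', nerveMap_eq_id]⟩

lemma isEquivalence_of_inverse {C D : Type} [SmallCategory C] [SmallCategory D] {F : C ⥤ D}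
    {G : D ⥤ C} (h : F ⋙ G = 𝟭 C) (h' : G ⋙ F = 𝟭 D) : F.IsEquivalence :=
  (CategoryTheory.Equivalence.mk F G (eqToIso h.symm) (eqToIso h')).isEquivalence_functor

/-- The maps of an isomorphism of simplicial categories are isomorphisms. -/
lemma isIso_fmap (e : C ≅ D) (x y : C.Ob) : IsIso (SCat.fmap e.hom x y) := by
  have (m : SimplexCategoryᵒᵖ) : IsIso ((SCat.fmap e.hom x y).app m) := by
    rw [isIso_iff_bijective]
    have h1 : ∀ z, SCat.fobj e.inv (SCat.fobj e.hom z) = z := SCat.fobj_eq_of_eq e.hom_inv_id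
    have h2 : ∀ z, SCat.fobj e.hom (SCat.fobj e.inv z) = z := SCat.fobj_eq_of_eq e.inv_hom_id
    constructor
    · intro f g hfg
      apply eq_of_heq
      refine (SCat.heq_of_eq e.hom_inv_id f).symm.trans (HEq.trans ?_
        (SCat.heq_of_eq e.hom_inv_id g))
      exact heq_of_eq (congrArg ((SCat.fmap e.inv _ _).app m) hfg)
    · intro g
      obtain ⟨v, hv⟩ := exists_hom_heq (h1 x) (h1 y)
        (SCat.fmap e.inv (SCat.fobj e.hom x) (SCat.fobj e.hom y))
      refine ⟨v.app m g, eq_of_heq ?_⟩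
      exact (SCat.fmap_heq e.hom (h1 x).symm (h1 y).symm (hv m g)).trans
        (SCat.heq_of_eq e.inv_hom_id g)
  exact NatIso.isIso_of_isIso_app _

end PiZero

/-! ### Contraction of the open box and of the cube onto the face `x_i = 0`, and the conclusion. -/

section

variable {n : ℕ} {i : Fin (n + 1)} {m m' : SimplexCategoryᵒᵖ}

namespace Cube

variable {J : Type} [LinearOrder J] {a b : J}

/-- Replace the coordinate at `j` by its infimum with `t`. -/
def cap (j : J) (f : Cube a b m) (t : Fin (m.unop.len + 1) →o Fin 2) : Cube a b m :=
  ⟨f.le, fun x => if x.1 = j then f.coord x ⊓ t else f.coord x⟩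

lemma cap_coord_le (j : J) (f : Cube a b m) (t : Fin (m.unop.len + 1) →o Fin 2)
    (x : Set.Ioo a b) : (f.cap j t).coord x ≤ f.coord x := by
  change (if x.1 = j then f.coord x ⊓ t else f.coord x) ≤ _
  split_ifs
  · exact inf_le_left
  · exact le_rfl

lemma Cuts.cap {c : J} {f : Cube a b m} (h : f.Cuts c) (j : J)
    (t : Fin (m.unop.len + 1) →o Fin 2) : (f.cap j t).Cuts c := by
  obtain ⟨hc, h⟩ := h
  exact ⟨hc, le_antisymm ((f.cap_coord_le j t _).trans h.le) fun _ => Fin.zero_le _⟩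

lemma Omits.cap {c : J} {f : Cube a b m} (h : f.Omits c) {j : J} (hj : c ≠ j)
    (t : Fin (m.unop.len + 1) →o Fin 2) : (f.cap j t).Omits c :=
  ⟨h.1, h.2.1, fun hc => (if_neg hj).trans (h.2.2 hc)⟩

lemma cap_res (j : J) (f : Cube a b m) (t : Fin (m.unop.len + 1) →o Fin 2) (θ : m ⟶ m') :
    (f.res θ).cap j (t.comp θ.unop.toOrderHom) = (f.cap j t).res θ := by
  refine Cube.ext (funext fun x => ?_)
  change (if x.1 = j then _ else _) = (if x.1 = j then _ else _ : _ →o _).comp _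
  split_ifs <;> rfl

lemma cap_one (j : J) (f : Cube a b m) : f.cap j (OrderHom.const _ 1) = f := by
  refine Cube.ext (funext fun x => ?_)
  change (if x.1 = j then _ else _) = _
  split_ifs
  · exact inf_eq_left.2 fun _ => Fin.le_last _
  · rfl

lemma cuts_cap_zero {j : J} (f : Cube a b m) (hj : j ∈ Set.Ioo a b) :
    (f.cap j (OrderHom.const _ 0)).Cuts j :=
  ⟨hj, (if_pos rfl).trans (inf_eq_right.2 fun _ => Fin.zero_le _)⟩

/-- Only the coordinate `i` is lowered. An omitted vertex `j ≠ i` stays omitted, and a coordinate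
`0` stays `0`; the one face that would not be preserved, `x_i = 1`, is not in the box. -/
lemma InBox.cap {a b : Fin (n + 1)} {f : Cube a b m} (h : f.InBox i)
    (t : Fin (m.unop.len + 1) →o Fin 2) : (f.cap i t).InBox i :=
  h.imp (fun ⟨j, hj, h⟩ => ⟨j, hj, h.cap hj t⟩) fun ⟨c, h⟩ => ⟨c, h.cap i t⟩

end Cube

variable {a b : Fin (n + 1)}

/-- The projection of a cube to its face `x_i = 0`. -/
def boxRetraction (hab : i ∈ Set.Ioo a b) : cubeHom a b ⟶ boxHom i a b where
  app m := ↾fun (f : Cube a b m) =>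
    ⟨f.cap i (OrderHom.const _ 0), Or.inr ⟨i, f.cuts_cap_zero hab⟩⟩
  naturality _ _ θ := by
    ext f
    exact Subtype.ext (Cube.cap_res i f (OrderHom.const _ 0) θ)

/-- The homotopy of the box that multiplies the `i`-th coordinate by a parameter. -/
def boxContraction (hab : i ∈ Set.Ioo a b) :
    SSet.Homotopy (boxHomι i a b ≫ boxRetraction hab) (𝟙 (boxHom i a b)) :=
  homotopyMk
    { app m := ↾fun p => ⟨p.1.1.cap i (SSet.stdSimplex.asOrderHom p.2), p.1.2.cap _⟩
      naturality _ _ θ := by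
        ext p
        exact Subtype.ext (Cube.cap_res i p.1.1 (SSet.stdSimplex.asOrderHom p.2) θ) }
    rfl (by
      ext m f
      exact Subtype.ext (Cube.cap_one i f.1))

/-- The homotopy of the cube that multiplies the `i`-th coordinate by a parameter. -/
def cubeContraction (hab : i ∈ Set.Ioo a b) :
    SSet.Homotopy (boxRetraction hab ≫ boxHomι i a b) (𝟙 (cubeHom a b)) :=
  homotopyMk
    { app m := ↾fun p => Cube.cap i p.1 (SSet.stdSimplex.asOrderHom p.2)
      naturality _ _ θ := by
        ext p
        exact Cube.cap_res i p.1 (SSet.stdSimplex.asOrderHom p.2) θ }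
    rfl (by
      ext m f
      exact Cube.cap_one i f)

variable (hi : 0 < i ∧ i < Fin.last n)

/-- If `i` is not between `a` and `b`, then `(a,b) ≠ (0,n)`, and every simplex is small. -/
lemma isIso_boxHomι (hi : 0 < i ∧ i < Fin.last n) (hab : i ∉ Set.Ioo a b) : IsIso (boxHomι i a b) := by
  have (m : SimplexCategoryᵒᵖ) : IsIso ((boxHomι i a b).app m) := by
    rw [isIso_iff_bijective]
    refine ⟨Subtype.val_injective, fun (f : Cube a b m) => ⟨⟨f, Or.inl ?_⟩, rfl⟩⟩
    by_cases ha : a = 0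
    · refine f.small_of_ne_last hi fun hb => hab ⟨ha ▸ hi.1, hb ▸ hi.2⟩
    · exact f.small_of_ne_zero hi ha
  exact NatIso.isIso_of_isIso_app _

lemma isWeakHomotopyEquiv_boxHomι (hi : 0 < i ∧ i < Fin.last n) (a b : Fin (n + 1)) :
    IsWeakHomotopyEquiv (boxHomι i a b) := by
  by_cases hab : i ∈ Set.Ioo a b
  · exact isWeakHomotopyEquiv_of_homotopies (boxContraction hab) (cubeContraction hab)
  · have := isIso_boxHomι hi hab
    exact isWeakHomotopyEquiv_of_isIso _

lemma mapπ₀_boxHomι_bijective (hi : 0 < i ∧ i < Fin.last n) (a b : Fin (n + 1)) :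
    Function.Bijective (SSet.mapπ₀ (boxHomι i a b)) := by
  by_cases hab : i ∈ Set.Ioo a b
  · exact mapπ₀_bijective_of_homotopies (boxContraction hab) (cubeContraction hab)
  · have := isIso_boxHomι hi hab
    have h : IsIso (SSet.π₀Functor.map (boxHomι i a b)) := inferInstance
    exact (isIso_iff_bijective _).1 h

lemma mapπ₀_fmap_boxι_bijective (a b : Fin (n + 1)) :
    Function.Bijective (SSet.mapπ₀ (SCat.fmap (boxι hi) a b)) :=
  mapπ₀_boxHomι_bijective hi a b

/-- The inverse of `π₀` of the inclusion of the simplicial subcategory generated by the horn. -/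
noncomputable def piZeroBoxInverse : PiZero (thick (Fin (n + 1))) ⥤ PiZero (boxCat hi) where
  obj x := ⟨x.as⟩
  map {x y} f := (Equiv.ofBijective _ (mapπ₀_fmap_boxι_bijective hi x.as y.as)).symm f
  map_id x := by
    refine (Equiv.symm_apply_eq _).2 ?_
    exact ((piZeroMap (boxι hi)).map_id ⟨x.as⟩).symm
  map_comp {x y z} f g := by
    refine (Equiv.symm_apply_eq _).2 ?_
    refine Eq.trans ?_ ((piZeroMap (boxι hi)).map_comp (X := ⟨x.as⟩) (Y := ⟨y.as⟩) (Z := ⟨z.as⟩)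
      _ _).symm
    exact congrArg₂ (fun (f : x ⟶ y) (g : y ⟶ z) => f ≫ g)
      (Equiv.apply_symm_apply (Equiv.ofBijective _ (mapπ₀_fmap_boxι_bijective hi x.as y.as)) f).symm
      (Equiv.apply_symm_apply (Equiv.ofBijective _ (mapπ₀_fmap_boxι_bijective hi y.as z.as)) g).symm

lemma piZeroMap_boxι_inverse : piZeroMap (boxι hi) ⋙ piZeroBoxInverse hi = 𝟭 _ :=
  CategoryTheory.Functor.hext (fun _ => rfl) fun x y f => by
    refine heq_of_eq ?_
    exact Equiv.symm_apply_apply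
      (Equiv.ofBijective _ (mapπ₀_fmap_boxι_bijective hi x.as y.as)) f

lemma piZeroBoxInverse_piZeroMap : piZeroBoxInverse hi ⋙ piZeroMap (boxι hi) = 𝟭 _ :=
  CategoryTheory.Functor.hext (fun _ => rfl) fun x y f => by
    refine heq_of_eq ?_
    exact Equiv.apply_symm_apply
      (Equiv.ofBijective _ (mapπ₀_fmap_boxι_bijective hi x.as y.as)) f

lemma hornMap_eq : hornMap n i = (hornIso hi).hom ≫ boxι hi := (hornToBox_boxι hi).symm

lemma cofibrations_hornMap (hi : 0 < i ∧ i < Fin.last n) :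
    cofibrations (hornMap n i) := by
  rw [hornMap_eq hi]
  exact MorphismProperty.comp_mem generatingCofibrations.rlp.llp _ _
    (MorphismProperty.of_isIso generatingCofibrations.rlp.llp _) (cofibrations_boxι hi)

/-- On `π₀` the functor has a strict inverse, so its nerve is an isomorphism and it is an
equivalence of categories. On maps it is an isomorphism followed by the inclusion of the box into
the cube. -/
lemma isStrongEquivalence_hornMap (hi : 0 < i ∧ i < Fin.last n) :
    IsStrongEquivalence (hornMap n i) := by
  have h1 : piZeroMap (hornMap n i) ⋙ piZeroBoxInverse hi ⋙ piZeroMap (hornIso hi).inv =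
      𝟭 _ := by
    rw [hornMap_eq hi, piZeroMap_comp, Functor.assoc, ← Functor.assoc (piZeroMap (boxι hi)),
      piZeroMap_boxι_inverse, Functor.id_comp, ← piZeroMap_comp, Iso.hom_inv_id, piZeroMap_id]
  have h2 : (piZeroBoxInverse hi ⋙ piZeroMap (hornIso hi).inv) ⋙ piZeroMap (hornMap n i) =
      𝟭 _ := by
    rw [hornMap_eq hi, piZeroMap_comp, Functor.assoc, ← Functor.assoc (piZeroMap (hornIso hi).inv),
      ← piZeroMap_comp, Iso.inv_hom_id, piZeroMap_id, Functor.id_comp, piZeroBoxInverse_piZeroMap]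
  refine { nerve_piZero := ?_, map := fun x y => ?_, piZero := isEquivalence_of_inverse h1 h2 }
  · have := isIso_nerveMap h1 h2
    exact isWeakHomotopyEquiv_of_isIso _
  · rw [hornMap_eq hi]
    have := isIso_fmap (hornIso hi) x y
    exact (isWeakHomotopyEquiv_of_isIso (SCat.fmap (hornIso hi).hom x y)).comp
      (isWeakHomotopyEquiv_boxHomι hi _ _)

end

end CohNerve

theorem proposition2p4 (n : ℕ) (i : Fin (n + 1)) (h_pos : 0 < i) (h_lt : i < Fin.last n) :
    CohNerve.IsStrongAcyclicCofibration (CohNerve.hornMap n i) :=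
  ⟨CohNerve.cofibrations_hornMap ⟨h_pos, h_lt⟩, CohNerve.isStrongEquivalence_hornMap ⟨h_pos, h_lt⟩⟩
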